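/- For $\alpha>0$ consider the six p-max stable laws (for $i=3,6$ the parameter $\alpha$ plays no role), given by the distribution functions - $H_{1,\alpha}(x)=\exp\{-(\log x)^{-\alpha}\}$ for $x>1$ and $0$ for $x\le 1$; - $H_{2,\alpha}(x)=\exp\{-(-\log x)^{\alpha}\}$ for $0<x<1$, $0$ for $x\le0$ and $1$ for $x\ge1$; - $H_3(x)=e^{-1/x}$ for $x>0$ and $0$ for $x\le0$; - $H_{4,\alpha}(x)=\exp\{-(-\log(-x))^{-\alpha}\}$ for $-1<x<0$, $0$ for $x\le-1$ and $1$ for $x\ge0$; - $H_{5,\alpha}(x)=\exp\{-(\log(-x))^{\alpha}\}$ for $x<-1$ and $1$ for $x\ge-1$; - $H_6(x)=e^{x}$ for $x\le0$ and $1$ for $x>0$. For $H=H_{i,\alpha}$ with density $h=H'$ put $w(x)=h(x)/H(x)$, $r(H)=\sup\{x:H(x)<1\}\in(-\infty,\infty]$, and let $T=T_{i,\alpha}=H^{-1}:(0,1)\to\mathbb R$ be the inverse of $H$. **Theorem.** Let $1/2<x_0<1$, $L>0$, $\delta>0$. There is a constant $D>0$, depending only on $x_0,L,\delta$, such that the following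 holds for every $i\in\{1,\dots,6\}$ and $\alpha>0$, with $H=H_{i,\alpha}$. Let $F$ be an absolutely continuous distribution function with a probability density $f$ such that $$f(x)=w(x)e^{g_i(x)}\quad\text{for } T(x_0)<x<r(H),\qquad f(x)=0\quad\text{for } x>r(H),$$ where for $T(x_0)<x<r(H)$ $$|g_i(x)|\le\begin{cases}L(\log x)^{-\alpha\delta}&i=1,\\ L(-\log x)^{\alpha\delta}&i=2,\\ Lx^{-\delta}&i=3,\\ L(-\log(-x))^{-\alpha\delta}&i=4,\\ L(\log(-x))^{\alpha\delta}&i=5,\\ L|x|^{\delta}&i=6.\end{cases}$$ Let $X_1,\dots,X_n$ be independent random variables with distribution function $F$, with order statistics $X_{1:n}\le\dots\le X_{n:n}$, and let $$A_n=\begin{cases}1&i=1,2,4,5,\\ n&i=3,\\ 1/n&i=6,\end{cases}\qquad B_n=\begin{cases}n^{1/\alpha}&i=1,4,\\ n^{-1/\alpha}&i=2,5,\\ 1&i=3,6.\end{cases}$$ Then for all integers $1\le k\le n$ $$\sup_B\left|P\left\{\left(\left|\frac{X_{n-j+1:n}}{A_n}\right|^{1/B_n}\operatorname{sign}(X_{n-j+1:n})\right)_{j=1}^k\in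 B\right\}-H_k(B)\right|\le D\left((k/n)^{\delta}k^{1/2}+k/n\right),$$ where the supremum is over all Borel sets $B\subseteq\mathbb R^k$ and $H_k$ is the limiting joint law of the $k$ largest order statistics, i.e. the probability measure on $\mathbb R^k$ with Lebesgue density $H(x_k)\prod_{j=1}^k w(x_j)$ at points $x_1>x_2>\dots>x_k$ of $\{0<H<1\}$, and $0$ elsewhere. -/

import Mathlib

open MeasureTheory ProbabilityTheory

noncomputable section

namespace PowerNorm

/-- Labels of the six families of p-max stable laws (max-stable under power normalization). -/
inductive LawType
  | one | two | three | four | five | six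

/-- The distribution functions `H_{1,α}, H_{2,α}, H_3, H_{4,α}, H_{5,α}, H_6` of the p-max stable
laws. The parameter `α` is irrelevant for `H_3` and `H_6`. (The value of `H_{2,α}` at `0` is
`exp (-∞) = 0`.) -/
def cdfH : LawType → ℝ → ℝ → ℝ
  | .one, α, x => if x ≤ 1 then 0 else Real.exp (-(Real.log x) ^ (-α))
  | .two, α, x =>
      if x ≤ 0 then 0 else if x < 1 then Real.exp (-(-Real.log x) ^ α) else 1
  | .three, _, x => if x ≤ 0 then 0 else Real.exp (-(1 / x))
  | .four, α, x =>
      if x ≤ -1 then 0 else if x < 0 then Real.exp (-(-Real.log (-x)) ^ (-α)) else 1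
  | .five, α, x => if x < -1 then Real.exp (-(Real.log (-x)) ^ α) else 1
  | .six, _, x => if x ≤ 0 then Real.exp x else 1

/-- The inverse `T_{i,α} = H_{i,α}⁻¹` on `(0, 1)`; see `cdfH_quantileT`. -/
def quantileT : LawType → ℝ → ℝ → ℝ
  | .one, α, u => Real.exp ((-Real.log u) ^ (-1 / α))
  | .two, α, u => Real.exp (-(-Real.log u) ^ (1 / α))
  | .three, _, u => -1 / Real.log u
  | .four, α, u => -Real.exp (-(-Real.log u) ^ (-1 / α))
  | .five, α, u => -Real.exp ((-Real.log u) ^ (1 / α))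
  | .six, _, u => Real.log u

theorem cdfH_quantileT (i : LawType) {α u : ℝ} (hα : 0 < α) (hu0 : 0 < u) (hu1 : u < 1) :
    cdfH i α (quantileT i α u) = u := by
  have hlog : 0 < -Real.log u := by linarith [Real.log_neg hu0 hu1]
  have hp : ∀ r : ℝ, 0 < (-Real.log u) ^ r := fun r => Real.rpow_pos_of_pos hlog r
  have e1 : ((-Real.log u) ^ (-1 / α)) ^ (-α) = -Real.log u := by
    rw [← Real.rpow_mul hlog.le]; field_simp; simp
  have e2 : ((-Real.log u) ^ (1 / α)) ^ α = -Real.log u := by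
    rw [← Real.rpow_mul hlog.le]; field_simp; simp
  have hE := Real.exp_log hu0
  cases i with
  | one =>
    have h : ¬ Real.exp ((-Real.log u) ^ (-1 / α)) ≤ 1 := by
      simpa using hp (-1 / α)
    simp only [cdfH, quantileT, if_neg h, Real.log_exp, e1, neg_neg, hE]
  | two =>
    have h : ¬ Real.exp (-(-Real.log u) ^ (1 / α)) ≤ 0 := not_le.2 (Real.exp_pos _)
    have h' : Real.exp (-(-Real.log u) ^ (1 / α)) < 1 := by
      simpa using hp (1 / α)
    simp only [cdfH, quantileT, if_neg h, if_pos h', Real.log_exp, neg_neg, e2, hE]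
  | three =>
    have h : ¬ (-1 / Real.log u ≤ 0) := by
      rw [not_le]; exact div_pos_of_neg_of_neg (by norm_num) (by linarith)
    have hne : Real.log u ≠ 0 := by linarith
    have h' : -(1 / (-1 / Real.log u)) = Real.log u := by field_simp
    simp only [cdfH, quantileT, if_neg h, h', hE]
  | four =>
    have h' : Real.exp (-(-Real.log u) ^ (-1 / α)) < 1 := by
      simpa using hp (-1 / α)
    have h : ¬ -Real.exp (-(-Real.log u) ^ (-1 / α)) ≤ -1 := by linarith
    have h'' : -Real.exp (-(-Real.log u) ^ (-1 / α)) < 0 := by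
      linarith [Real.exp_pos (-(-Real.log u) ^ (-1 / α))]
    simp only [cdfH, quantileT, if_neg h, if_pos h'', Real.log_exp, neg_neg, e1, hE]
  | five =>
    have h' : 1 < Real.exp ((-Real.log u) ^ (1 / α)) := by
      simpa using hp (1 / α)
    have h : -Real.exp ((-Real.log u) ^ (1 / α)) < -1 := by linarith
    simp only [cdfH, quantileT, if_pos h, Real.log_exp, neg_neg, e2, hE]
  | six =>
    have h : Real.log u ≤ 0 := by linarith
    simp only [cdfH, quantileT, if_pos h, hE]

/-- The auxiliary function `w = h / H`, where `h = H'` is the density of `H`. -/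
def auxW (H : ℝ → ℝ) (x : ℝ) : ℝ := deriv H x / H x

/-- The right extremity `r(H) = sup {x : H x < 1}`, possibly `+∞`. -/
def rightEnd (H : ℝ → ℝ) : EReal := sSup ((fun x : ℝ => (x : EReal)) '' {x : ℝ | H x < 1})

/-- The function of `x` bounding `|g_i|` (up to the factor `L`). -/
def gRate : LawType → ℝ → ℝ → ℝ → ℝ
  | .one, α, δ, x => (Real.log x) ^ (-(α * δ))
  | .two, α, δ, x => (-Real.log x) ^ (α * δ)
  | .three, _, δ, x => 1 / x ^ δ
  | .four, α, δ, x => (-Real.log (-x)) ^ (-(α * δ))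
  | .five, α, δ, x => (Real.log (-x)) ^ (α * δ)
  | .six, _, δ, x => |x| ^ δ

/-- The norming constant `A_n`. -/
def normA : LawType → ℕ → ℝ
  | .three, n => n
  | .six, n => 1 / n
  | _, _ => 1

/-- The norming exponent `B_n`. -/
def normB : LawType → ℝ → ℕ → ℝ
  | .one, α, n | .four, α, n => (n : ℝ) ^ (1 / α)
  | .two, α, n | .five, α, n => (n : ℝ) ^ (-1 / α)
  | .three, _, _ | .six, _, _ => 1

/-- Power normalization `x ↦ |x / A|^{1/B} sign x`. -/
def powNormalize (A B x : ℝ) : ℝ := |x / A| ^ (1 / B) * Real.sign x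

/-- The `j`-th largest (`j = 0` is the largest) of the numbers `x 0, …, x (n-1)`, for `j < k ≤ n`.
`Tuple.sort x` is the permutation that puts `x` into increasing order. -/
def upperOrderStat {n k : ℕ} (hkn : k ≤ n) (x : Fin n → ℝ) (j : Fin k) : ℝ :=
  x (Tuple.sort x (Fin.rev (Fin.castLE hkn j)))

/-- The limiting joint law `H_k` of the `k` largest order statistics belonging to the limit
distribution function `H` of the maximum: the law on `ℝ^k` with Lebesgue density
`H(x_k) ∏_{j ≤ k} w(x_j) = h(x_k) ∏_{j < k} h(x_j) / H(x_j)` on `x_1 > x_2 > ⋯ > x_k`, and `0`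
elsewhere. (Outside the support of `H` the factors `w(x_j)` vanish.) -/
def limitLaw (H : ℝ → ℝ) (k : ℕ) (hk : 1 ≤ k) : Measure (Fin k → ℝ) :=
  volume.withDensity
    ({x : Fin k → ℝ | StrictAnti x}.indicator fun x =>
      ENNReal.ofReal (H (x ⟨k - 1, Nat.sub_lt hk Nat.one_pos⟩) * ∏ j, auxW H (x j)))

end PowerNorm

end

open MeasureTheory ProbabilityTheory

noncomputable section

namespace PowerNorm

open Set Filter Topology
open scoped ENNReal

/-! Put `τ y = T (exp (-y))`, a decreasing map (`arrivalMap`). It turns the six laws into one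
problem. Since `H (τ y) = exp (-y)`, the limit law is the image under `τ` of the first `k` arrival
times of a unit Poisson process (`limitLaw_apply`). The power normalization sends `τ (y / n)` to `τ
y` (`powNormalize_arrivalMap`), and every bound on `g_i` becomes `L * y ^ δ` (`gRate_arrivalMap`).
In the coordinate `s` with `x = τ (s / n)`, each observation has density `exp (φ s) / n` on `(0, n *
y₀)`, where `|φ s| ≤ L * (s / n) ^ δ` and `y₀ = -log x₀`.

Two comparisons remain, both made in `exists_poissonArrivals_le`. Homogeneous against inhomogeneous
arrivals: with `Θ = timeChange φ`, the likelihood ratio is `exp (-Z)`, and by Campbell's formula the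
divergence `E Z` equals the mean of `∫ (exp φ - 1 - φ)` over `(0, s_k)`. This is of order `∫ φ ^ 2`,
hence at most a constant times `k ^ (1 + 2 * δ) / n ^ (2 * δ)`; its square root is the term `(k / n)
^ δ * k ^ (1 / 2)`. Poisson against binomial: the ratio of likelihoods at `x = Θ (s_k)` is at least
`1 - 4 * (x - k) ^ 2 / n`. Under the inhomogeneous law `x` is a Gamma variable with mean and
variance `k`, so the loss is of order `k / n`.

The binomial likelihood bounds the law of the upper order statistics from below, because the `k`
largest values are found by summing over the injections `Fin k ↪ Fin n` (`pi_iUnion_topEvent`). All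
estimates are one-sided, limit probability at most sample probability plus error; applying them to
`B` and to its complement gives the absolute value. -/

/-! ### Products of measures with densities. -/

theorem lintegral_pi_fin_prod {k : ℕ} (μ : Fin k → Measure ℝ) [∀ i, SigmaFinite (μ i)]
    {f : Fin k → ℝ → ℝ≥0∞} (hf : ∀ i, Measurable (f i)) :
    ∫⁻ x, ∏ i, f i (x i) ∂(Measure.pi μ) = ∏ i, ∫⁻ x, f i x ∂(μ i) := by
  induction k with
  | zero => simp
  | succ k ih =>
    rw [← (measurePreserving_piFinSuccAbove μ 0).symm.lintegral_comp (by fun_prop),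
      lintegral_prod _ (by fun_prop)]
    simp only [MeasurableEquiv.piFinSuccAbove_symm_apply, Fin.insertNthEquiv_apply,
      Fin.prod_univ_succ, Fin.insertNth_zero', Fin.cons_zero,
      Fin.cons_succ, Fin.succAbove_zero]
    have h : ∀ x : ℝ, ∫⁻ y : Fin k → ℝ, f 0 x * ∏ i, f (Fin.succ i) (y i)
        ∂(Measure.pi fun j => μ j.succ) = f 0 x * ∏ i : Fin k, ∫⁻ x, f i.succ x ∂(μ i.succ) := by
      intro x
      rw [lintegral_const_mul _ (by fun_prop), ih (fun j => μ j.succ) (fun i => hf i.succ)]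
    simp only [h]
    rw [lintegral_mul_const _ (hf 0)]

theorem pi_withDensity {k : ℕ} (μ : Fin k → Measure ℝ) [∀ i, SigmaFinite (μ i)]
    {f : Fin k → ℝ → ℝ≥0∞} (hf : ∀ i, Measurable (f i))
    [∀ i, SigmaFinite ((μ i).withDensity (f i))] :
    Measure.pi (fun i => (μ i).withDensity (f i)) =
      (Measure.pi μ).withDensity (fun x => ∏ i, f i (x i)) := by
  refine Measure.pi_eq fun s hs => ?_
  rw [withDensity_apply _ (MeasurableSet.univ_pi hs), Measure.restrict_pi_pi,
    lintegral_pi_fin_prod _ hf]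
  simp only [withDensity_apply _ (hs _)]

/-! ### Poisson arrival times and their recursion in the number of points. -/

/-- The law of the first `m + 1` arrival times of a unit rate Poisson process. -/
def poissonArrivals (m : ℕ) : Measure (Fin (m + 1) → ℝ) :=
  (Measure.pi fun _ => volume.restrict (Ioi 0)).withDensity
    ({s | StrictMono s}.indicator fun s => ENNReal.ofReal (Real.exp (-(s (Fin.last m)))))

theorem measurableSet_strictMono (k : ℕ) : MeasurableSet {s : Fin k → ℝ | StrictMono s} := by
  have : {s : Fin k → ℝ | StrictMono s} = ⋂ i, ⋂ j, ⋂ (_ : i < j), {s | s i < s j} := by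
    ext s; simp [StrictMono]
  rw [this]
  exact MeasurableSet.iInter fun i => MeasurableSet.iInter fun j => MeasurableSet.iInter fun _ =>
    measurableSet_lt (measurable_pi_apply i) (measurable_pi_apply j)

theorem measurableSet_strictAnti (k : ℕ) : MeasurableSet {s : Fin k → ℝ | StrictAnti s} := by
  have : {s : Fin k → ℝ | StrictAnti s} = ⋂ i, ⋂ j, ⋂ (_ : i < j), {s | s j < s i} := by
    ext s; simp [StrictAnti]
  rw [this]
  exact MeasurableSet.iInter fun i => MeasurableSet.iInter fun j => MeasurableSet.iInter fun _ =>
    measurableSet_lt (measurable_pi_apply j) (measurable_pi_apply i)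

theorem measurable_arrivalDensity (m : ℕ) : Measurable
    ({s : Fin (m + 1) → ℝ | StrictMono s}.indicator
      fun s => ENNReal.ofReal (Real.exp (-(s (Fin.last m))))) :=
  Measurable.indicator (by fun_prop) (measurableSet_strictMono _)

theorem lintegral_poissonArrivals (m : ℕ) {F : (Fin (m + 1) → ℝ) → ℝ≥0∞} (hF : Measurable F) :
    ∫⁻ s, F s ∂(poissonArrivals m) =
      ∫⁻ s, {s : Fin (m + 1) → ℝ | StrictMono s}.indicator
        (fun s => ENNReal.ofReal (Real.exp (-(s (Fin.last m)))) * F s) s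
        ∂(Measure.pi fun _ : Fin (m + 1) => volume.restrict (Ioi (0 : ℝ))) := by
  rw [poissonArrivals, lintegral_withDensity_eq_lintegral_mul _ (measurable_arrivalDensity m) hF]
  refine lintegral_congr fun s => ?_
  by_cases h : StrictMono s <;> simp [indicator, h]

theorem ae_pos_pi (k : ℕ) :
    ∀ᵐ s : Fin k → ℝ ∂(Measure.pi fun _ : Fin k => volume.restrict (Ioi (0 : ℝ))),
      ∀ i, 0 < s i := by
  rw [ae_all_iff]
  intro i
  exact Measure.tendsto_eval_ae_ae.eventually (ae_restrict_mem measurableSet_Ioi)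

theorem ae_pos_poissonArrivals (m : ℕ) : ∀ᵐ s ∂(poissonArrivals m), ∀ i, 0 < s i :=
  (withDensity_absolutelyContinuous _ _).ae_le (ae_pos_pi _)

/-- The expectation of `f` at `x` plus a standard exponential variable. -/
def expShift (f : ℝ → ℝ≥0∞) (x : ℝ) : ℝ≥0∞ :=
  ∫⁻ e in Ioi (0 : ℝ), ENNReal.ofReal (Real.exp (-e)) * f (x + e)

theorem setLIntegral_Ioi_eq_shift (G : ℝ → ℝ≥0∞) (x : ℝ) :
    ∫⁻ t in Ioi x, G t = ∫⁻ e in Ioi (0 : ℝ), G (x + e) := by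
  rw [← lintegral_indicator measurableSet_Ioi, ← lintegral_indicator measurableSet_Ioi,
    ← lintegral_add_left_eq_self _ x]
  refine lintegral_congr fun e => ?_
  simp [indicator]

theorem strictMono_snoc_iff {m : ℕ} (s : Fin (m + 1) → ℝ) (t : ℝ) :
    StrictMono (Fin.snoc s t : Fin (m + 2) → ℝ) ↔ StrictMono s ∧ s (Fin.last m) < t := by
  rw [Fin.strictMono_iff_lt_succ, Fin.strictMono_iff_lt_succ]
  constructor
  · intro h
    refine ⟨fun i => ?_, ?_⟩
    · have := h i.castSucc
      rw [← Fin.castSucc_succ] at this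
      simpa only [Fin.snoc_castSucc] using this
    · have := h (Fin.last m)
      rw [Fin.succ_last] at this
      simpa only [Fin.snoc_castSucc, Fin.snoc_last] using this
  · rintro ⟨h, h'⟩ i
    induction i using Fin.lastCases with
    | last => rw [Fin.succ_last]; simpa only [Fin.snoc_castSucc, Fin.snoc_last] using h'
    | cast i => rw [← Fin.castSucc_succ]; simpa only [Fin.snoc_castSucc] using h i

theorem measurable_snoc (m : ℕ) :
    Measurable (fun p : (Fin m → ℝ) × ℝ => (Fin.snoc p.1 p.2 : Fin (m + 1) → ℝ)) := by
  refine measurable_pi_lambda _ fun i => ?_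
  induction i using Fin.lastCases with
  | last => simpa using measurable_snd
  | cast i => simpa only [Fin.snoc_castSucc] using (by fun_prop :
      Measurable fun p : (Fin m → ℝ) × ℝ => p.1 i)

theorem lintegral_poissonArrivals_zero {F : (Fin 1 → ℝ) → ℝ≥0∞} (hF : Measurable F) :
    ∫⁻ s, F s ∂(poissonArrivals 0) =
      ∫⁻ e in Ioi (0 : ℝ), ENNReal.ofReal (Real.exp (-e)) * F (fun _ => e) := by
  have hm : Measurable ({s : Fin 1 → ℝ | StrictMono s}.indicator
        (fun s => ENNReal.ofReal (Real.exp (-(s (Fin.last 0)))) * F s)) :=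
    Measurable.indicator (by fun_prop) (measurableSet_strictMono _)
  rw [lintegral_poissonArrivals 0 hF]
  refine (((measurePreserving_funUnique (volume.restrict (Ioi (0 : ℝ)))
    (Fin 1)).symm).lintegral_comp hm).symm.trans ?_
  · refine lintegral_congr fun e => ?_
    rw [indicator_of_mem]
    · rfl
    · exact Subsingleton.strictMono _

/-- The density `exp (-t)` on `t > s_m` factors as `exp (-s_m) * exp (-(t - s_m))`, so the new
arrival is the last one plus an independent standard exponential. All moment computations below are
inductions on this recursion. -/
theorem lintegral_poissonArrivals_succ (m : ℕ) {F : (Fin (m + 2) → ℝ) → ℝ≥0∞}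
    (hF : Measurable F) :
    ∫⁻ s, F s ∂(poissonArrivals (m + 1)) =
      ∫⁻ s, (∫⁻ e in Ioi (0 : ℝ), ENNReal.ofReal (Real.exp (-e)) *
        F (Fin.snoc s (s (Fin.last m) + e))) ∂(poissonArrivals m) := by
  have hsn := measurable_snoc (m + 1)
  have hm1 : Measurable (fun p : (Fin (m + 1) → ℝ) × ℝ =>
      ENNReal.ofReal (Real.exp (-p.2)) * F (Fin.snoc p.1 (p.1 (Fin.last m) + p.2))) := by
    refine Measurable.mul (by fun_prop) (hF.comp ?_)
    exact hsn.comp (by fun_prop : Measurable fun p : (Fin (m + 1) → ℝ) × ℝ =>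
      (p.1, p.1 (Fin.last m) + p.2))
  have hm2 : Measurable ({s : Fin (m + 2) → ℝ | StrictMono s}.indicator
        (fun s => ENNReal.ofReal (Real.exp (-(s (Fin.last (m + 1))))) * F s)) :=
    Measurable.indicator (by fun_prop) (measurableSet_strictMono _)
  rw [lintegral_poissonArrivals (m + 1) hF, lintegral_poissonArrivals m
    (Measurable.lintegral_prod_right' (ν := volume.restrict (Ioi (0 : ℝ))) hm1),
    ← (measurePreserving_piFinSuccAbove (fun _ : Fin (m + 2) => volume.restrict (Ioi (0 : ℝ)))
      (Fin.last (m + 1))).symm.lintegral_comp hm2]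
  rw [lintegral_prod_symm _ (by
    exact (hm2.comp (MeasurableEquiv.measurable _)).aemeasurable)]
  refine lintegral_congr_ae ?_
  filter_upwards [ae_pos_pi (m + 1)] with s hs
  have h0 : ∀ t, (MeasurableEquiv.piFinSuccAbove (fun _ : Fin (m + 2) => ℝ)
      (Fin.last (m + 1))).symm (t, s) = Fin.snoc s t := by
    intro t
    simp [MeasurableEquiv.piFinSuccAbove_symm_apply, Fin.snocEquiv]
  simp only [h0]
  by_cases hs' : StrictMono s
  · rw [indicator_of_mem (by exact hs')]
    have h1 : ∀ t, {s : Fin (m + 2) → ℝ | StrictMono s}.indicator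
        (fun s => ENNReal.ofReal (Real.exp (-(s (Fin.last (m + 1))))) * F s) (Fin.snoc s t) =
        (Ioi (s (Fin.last m))).indicator
          (fun t => ENNReal.ofReal (Real.exp (-t)) * F (Fin.snoc s t)) t := by
      intro t
      by_cases ht : s (Fin.last m) < t
      · rw [indicator_of_mem (show t ∈ Ioi _ from ht), indicator_of_mem
          (by exact (strictMono_snoc_iff s t).2 ⟨hs', ht⟩), Fin.snoc_last]
      · rw [indicator_of_notMem (show t ∉ Ioi _ from ht), indicator_of_notMem
          (by exact fun h => ht ((strictMono_snoc_iff s t).1 h).2)]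
    simp only [h1]
    rw [lintegral_indicator measurableSet_Ioi, Measure.restrict_restrict measurableSet_Ioi,
      inter_eq_left.2 (Ioi_subset_Ioi (hs _).le), setLIntegral_Ioi_eq_shift,
      ← lintegral_const_mul]
    · refine lintegral_congr fun e => ?_
      rw [neg_add, Real.exp_add, ENNReal.ofReal_mul (Real.exp_pos _).le, mul_assoc]
    · exact hm1.comp measurable_prodMk_left
  · rw [indicator_of_notMem (by exact hs')]
    have h1 : ∀ t, {s : Fin (m + 2) → ℝ | StrictMono s}.indicator
        (fun s => ENNReal.ofReal (Real.exp (-(s (Fin.last (m + 1))))) * F s) (Fin.snoc s t) = 0 :=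
      fun t => indicator_of_notMem (by exact fun h => hs' ((strictMono_snoc_iff s t).1 h).1) _
    simp [h1]

theorem lintegral_last_zero {f : ℝ → ℝ≥0∞} (hf : Measurable f) :
    ∫⁻ s, f (s (Fin.last 0)) ∂(poissonArrivals 0) = expShift f 0 := by
  rw [lintegral_poissonArrivals_zero (by fun_prop)]
  simp [expShift]

theorem lintegral_last_succ (m : ℕ) {f : ℝ → ℝ≥0∞} (hf : Measurable f) :
    ∫⁻ s, f (s (Fin.last (m + 1))) ∂(poissonArrivals (m + 1)) =
      ∫⁻ s, expShift f (s (Fin.last m)) ∂(poissonArrivals m) := by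
  rw [lintegral_poissonArrivals_succ _ (by fun_prop)]
  simp [expShift]

theorem lintegral_exp_neg_Ioi_zero :
    ∫⁻ e in Ioi (0 : ℝ), ENNReal.ofReal (Real.exp (-e)) = 1 := by
  rw [← ofReal_integral_eq_lintegral_ofReal, integral_exp_neg_Ioi_zero, ENNReal.ofReal_one]
  · exact (integrableOn_exp_neg_Ioi 0)
  · exact Filter.Eventually.of_forall fun _ => (Real.exp_pos _).le

theorem lintegral_exp_neg_Ioi (u : ℝ) :
    ∫⁻ e in Ioi u, ENNReal.ofReal (Real.exp (-e)) = ENNReal.ofReal (Real.exp (-u)) := by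
  rw [setLIntegral_Ioi_eq_shift]
  simp only [neg_add, Real.exp_add, ENNReal.ofReal_mul (Real.exp_pos (-u)).le]
  rw [lintegral_const_mul _ (by fun_prop), lintegral_exp_neg_Ioi_zero, mul_one]

theorem expShift_const (c : ℝ≥0∞) (x : ℝ) : expShift (fun _ => c) x = c := by
  rw [expShift, lintegral_mul_const _ (by fun_prop), lintegral_exp_neg_Ioi_zero, one_mul]

/-- The exponential law has mean 1 and variance 1. One step of the recursion therefore only moves
the centre from `c` to `c - 1` and adds 1, which keeps the family of quadratics closed under
induction. -/
theorem expShift_sq (c x : ℝ) :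
    expShift (fun t => ENNReal.ofReal ((t - c) ^ 2)) x =
      ENNReal.ofReal ((x - (c - 1)) ^ 2 + 1) := by
  have i1 : IntegrableOn (fun e : ℝ => Real.exp (-e)) (Ioi 0) := integrableOn_exp_neg_Ioi 0
  have i2 : IntegrableOn (fun e : ℝ => Real.exp (-e) * e) (Ioi 0) := by
    simpa [show (2 : ℝ) - 1 = 1 by norm_num] using
      Real.GammaIntegral_convergent (s := 2) (by norm_num)
  have i3 : IntegrableOn (fun e : ℝ => Real.exp (-e) * e ^ 2) (Ioi 0) := by
    have := Real.GammaIntegral_convergent (s := 3) (by norm_num)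
    simpa [show (3 : ℝ) - 1 = 2 by norm_num] using this
  have v1 : ∫ e in Ioi (0 : ℝ), Real.exp (-e) = 1 := integral_exp_neg_Ioi_zero
  have v2 : ∫ e in Ioi (0 : ℝ), Real.exp (-e) * e = 1 := by
    have := Real.Gamma_eq_integral (s := 2) (by norm_num)
    rw [Real.Gamma_two] at this
    simpa [show (2 : ℝ) - 1 = 1 by norm_num] using this.symm
  have v3 : ∫ e in Ioi (0 : ℝ), Real.exp (-e) * e ^ 2 = 2 := by
    have := Real.Gamma_eq_integral (s := 3) (by norm_num)
    rw [show (3 : ℝ) = 2 + 1 by norm_num, Real.Gamma_add_one (by norm_num), Real.Gamma_two]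
      at this
    simpa [show (2 + 1 : ℝ) - 1 = 2 by norm_num] using this.symm
  have heq : ∀ e : ℝ, Real.exp (-e) * (x + e - c) ^ 2 =
      (x - c) ^ 2 * Real.exp (-e) + 2 * (x - c) * (Real.exp (-e) * e) +
        Real.exp (-e) * e ^ 2 := fun e => by ring
  have j1 := i1.const_mul ((x - c) ^ 2)
  have j2 := i2.const_mul (2 * (x - c))
  have hint : IntegrableOn (fun e : ℝ => Real.exp (-e) * (x + e - c) ^ 2) (Ioi 0) := by
    simp only [heq]
    exact (j1.add j2).add i3
  have hval : ∫ e in Ioi (0 : ℝ), Real.exp (-e) * (x + e - c) ^ 2 = (x - (c - 1)) ^ 2 + 1 := by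
    simp only [heq]
    rw [integral_add (by exact j1.add j2) i3, integral_add j1 j2, integral_const_mul,
      integral_const_mul, v1, v2, v3]
    ring
  rw [← hval, ofReal_integral_eq_lintegral_ofReal hint
    (Filter.Eventually.of_forall fun e => by positivity), expShift]
  exact lintegral_congr fun e => (ENNReal.ofReal_mul (Real.exp_pos _).le).symm

theorem expShift_exp {θ : ℝ} (hθ : θ < 1) (x : ℝ) :
    expShift (fun t => ENNReal.ofReal (Real.exp (θ * t))) x =
      ENNReal.ofReal (1 / (1 - θ)) * ENNReal.ofReal (Real.exp (θ * x)) := by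
  have heq : ∀ e : ℝ, Real.exp (-e) * Real.exp (θ * (x + e)) =
      Real.exp (θ * x) * Real.exp ((θ - 1) * e) := fun e => by
    rw [← Real.exp_add, ← Real.exp_add]; ring_nf
  have hneg : θ - 1 < 0 := by linarith
  have hint : IntegrableOn (fun e : ℝ => Real.exp (-e) * Real.exp (θ * (x + e))) (Ioi 0) := by
    simp only [heq]
    exact (integrableOn_exp_mul_Ioi hneg 0).const_mul _
  have hval : ∫ e in Ioi (0 : ℝ), Real.exp (-e) * Real.exp (θ * (x + e)) =
      1 / (1 - θ) * Real.exp (θ * x) := by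
    simp only [heq]
    rw [integral_const_mul, integral_exp_mul_Ioi hneg]
    rw [mul_zero, Real.exp_zero, ← neg_sub 1 θ, neg_div_neg_eq, mul_comm]
  have h0 : 0 ≤ 1 / (1 - θ) := div_nonneg zero_le_one (by linarith)
  rw [← ENNReal.ofReal_mul h0, ← hval, ofReal_integral_eq_lintegral_ofReal hint
    (Filter.Eventually.of_forall fun e => by positivity), expShift]
  exact lintegral_congr fun e => (ENNReal.ofReal_mul (Real.exp_pos _).le).symm

/-- By Fubini, the part of the integral beyond `x` weights `φ (x + u)` by the probability that the
exponential variable is at least `u`. That tail `exp (-u)` coincides with the density, so the result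
is `expShift φ x`. This is the induction step of Campbell's formula. -/
theorem expShift_primitive {φ : ℝ → ℝ≥0∞} (hφ : Measurable φ) {x : ℝ} (hx : 0 ≤ x) :
    expShift (fun t => ∫⁻ u in Ioc 0 t, φ u) x = (∫⁻ u in Ioc 0 x, φ u) + expShift φ x := by
  have h1 : ∀ e ∈ Ioi (0 : ℝ), ∫⁻ u in Ioc 0 (x + e), φ u =
      (∫⁻ u in Ioc 0 x, φ u) + ∫⁻ u in Ioi (0 : ℝ), (Ici u).indicator (fun _ => φ (x + u)) e := by
    intro e he
    have he' : (0 : ℝ) < e := he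
    rw [← Ioc_union_Ioc_eq_Ioc hx (by linarith : x ≤ x + e), lintegral_union measurableSet_Ioc
      (by rw [Set.disjoint_left]; intro a ha hb; exact absurd ha.2 (not_le.2 hb.1))]
    congr 1
    rw [← Ioi_inter_Iic, inter_comm, ← Measure.restrict_restrict measurableSet_Iic,
      ← lintegral_indicator measurableSet_Iic, setLIntegral_Ioi_eq_shift]
    refine lintegral_congr fun u => ?_
    simp [indicator]
  have hm : Measurable (Function.uncurry fun e u : ℝ => ENNReal.ofReal (Real.exp (-e)) *
      (Ici u).indicator (fun _ => φ (x + u)) e) := by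
    refine Measurable.mul (by fun_prop) ?_
    have : (Function.uncurry fun e u : ℝ => (Ici u).indicator (fun _ => φ (x + u)) e) =
        {p : ℝ × ℝ | p.2 ≤ p.1}.indicator (fun p => φ (x + p.2)) := by
      ext ⟨e, u⟩; simp [indicator]
    have hmeas : Measurable (Function.uncurry
        fun e u : ℝ => (Ici u).indicator (fun _ => φ (x + u)) e) := by
      rw [this]
      exact Measurable.indicator (by fun_prop) (measurableSet_le measurable_snd measurable_fst)
    exact hmeas
  rw [expShift, setLIntegral_congr_fun measurableSet_Ioi
    (fun e he => congrArg (ENNReal.ofReal (Real.exp (-e)) * ·) (h1 e he))]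
  simp only [mul_add]
  rw [lintegral_add_left (by fun_prop), lintegral_mul_const _ (by fun_prop),
    lintegral_exp_neg_Ioi_zero, one_mul]
  congr 1
  have h2 : ∀ e : ℝ, ENNReal.ofReal (Real.exp (-e)) *
      ∫⁻ u in Ioi (0 : ℝ), (Ici u).indicator (fun _ => φ (x + u)) e =
      ∫⁻ u in Ioi (0 : ℝ), ENNReal.ofReal (Real.exp (-e)) *
        (Ici u).indicator (fun _ => φ (x + u)) e := by
    intro e
    rw [lintegral_const_mul]
    have : (fun u : ℝ => (Ici u).indicator (fun _ => φ (x + u)) e) =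
        (Iic e).indicator (fun u => φ (x + u)) := by
      ext u; simp [indicator]
    rw [this]
    exact Measurable.indicator (by fun_prop) measurableSet_Iic
  simp only [h2]
  rw [lintegral_lintegral_swap hm.aemeasurable, expShift]
  refine setLIntegral_congr_fun measurableSet_Ioi fun u hu => ?_
  have h3 : ∀ e : ℝ, ENNReal.ofReal (Real.exp (-e)) * (Ici u).indicator (fun _ => φ (x + u)) e =
      (Ici u).indicator (fun e => ENNReal.ofReal (Real.exp (-e)) * φ (x + u)) e := by
    intro e
    by_cases h : e ∈ Ici u <;> simp [h]
  have h4 : Ici u ⊆ Ioi 0 := fun a ha => lt_of_lt_of_le (mem_Ioi.1 hu) (mem_Ici.1 ha)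
  simp only [h3]
  rw [lintegral_indicator measurableSet_Ici, Measure.restrict_restrict measurableSet_Ici,
    inter_eq_left.2 h4,
    setLIntegral_congr (Ioi_ae_eq_Ici (a := u)).symm, lintegral_mul_const _ (by fun_prop),
    lintegral_exp_neg_Ioi]

/-! ### Moments of the last arrival and Campbell's formula. -/

instance isProbabilityMeasure_poissonArrivals (m : ℕ) :
    IsProbabilityMeasure (poissonArrivals m) := by
  constructor
  rw [← lintegral_one]
  induction m with
  | zero =>
    rw [lintegral_last_zero (f := fun _ => 1) measurable_const, expShift_const]
  | succ m ih =>
    rw [lintegral_last_succ m (f := fun _ => 1) measurable_const]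
    simpa only [expShift_const] using ih

theorem lintegral_sq_poissonArrivals (m : ℕ) (c : ℝ) :
    ∫⁻ s, ENNReal.ofReal ((s (Fin.last m) - c) ^ 2) ∂(poissonArrivals m) =
      ENNReal.ofReal ((m + 1 - c) ^ 2 + (m + 1)) := by
  induction m generalizing c with
  | zero =>
    rw [lintegral_last_zero (f := fun t => ENNReal.ofReal ((t - c) ^ 2)) (by fun_prop),
      expShift_sq]
    congr 1; push_cast; ring
  | succ m ih =>
    rw [lintegral_last_succ m (f := fun t => ENNReal.ofReal ((t - c) ^ 2)) (by fun_prop)]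
    simp only [expShift_sq]
    simp only [ENNReal.ofReal_add (sq_nonneg _) zero_le_one]
    rw [lintegral_add_right _ measurable_const, ih, lintegral_const, measure_univ, mul_one,
      ← ENNReal.ofReal_add (by positivity) zero_le_one]
    congr 1; push_cast; ring

theorem lintegral_exp_poissonArrivals (m : ℕ) {θ : ℝ} (hθ : θ < 1) :
    ∫⁻ s, ENNReal.ofReal (Real.exp (θ * s (Fin.last m))) ∂(poissonArrivals m) =
      ENNReal.ofReal (1 / (1 - θ)) ^ (m + 1) := by
  induction m with
  | zero =>
    rw [lintegral_last_zero (f := fun t => ENNReal.ofReal (Real.exp (θ * t))) (by fun_prop),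
      expShift_exp hθ]
    simp
  | succ m ih =>
    rw [lintegral_last_succ m (f := fun t => ENNReal.ofReal (Real.exp (θ * t))) (by fun_prop)]
    simp only [expShift_exp hθ]
    rw [lintegral_const_mul _ (by fun_prop), ih, pow_succ' _ (m + 1)]

theorem measurable_primitive {φ : ℝ → ℝ≥0∞} (hφ : Measurable φ) :
    Measurable fun t : ℝ => ∫⁻ u in Ioc 0 t, φ u := by
  have : (fun t : ℝ => ∫⁻ u in Ioc 0 t, φ u) = fun t : ℝ => ∫⁻ u : ℝ,
      {p : ℝ × ℝ | 0 < p.2 ∧ p.2 ≤ p.1}.indicator (fun p => φ p.2) (t, u) := by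
    ext t
    rw [← lintegral_indicator measurableSet_Ioc]
    exact lintegral_congr fun u => by simp [indicator]
  rw [this]
  refine Measurable.lintegral_prod_right' (Measurable.indicator (by fun_prop) ?_)
  exact (measurableSet_lt measurable_const measurable_snd).inter
    (measurableSet_le measurable_snd measurable_fst)

/-- Campbell's formula for the first arrivals, with the compensator on the right. -/
theorem lintegral_sum_poissonArrivals (m : ℕ) {φ : ℝ → ℝ≥0∞} (hφ : Measurable φ) :
    ∫⁻ s, ∑ j, φ (s j) ∂(poissonArrivals m) =
      ∫⁻ s, (∫⁻ u in Ioc 0 (s (Fin.last m)), φ u) ∂(poissonArrivals m) := by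
  induction m with
  | zero =>
    rw [lintegral_last_zero (measurable_primitive hφ), expShift_primitive hφ le_rfl]
    simp only [Ioc_self, Measure.restrict_empty, lintegral_zero_measure, zero_add]
    simpa using lintegral_last_zero hφ
  | succ m ih =>
    rw [lintegral_last_succ m (measurable_primitive hφ), lintegral_poissonArrivals_succ _
      (by fun_prop)]
    have h1 : ∀ s : Fin (m + 1) → ℝ, ∫⁻ e in Ioi (0 : ℝ), ENNReal.ofReal (Real.exp (-e)) *
        ∑ j, φ ((Fin.snoc s (s (Fin.last m) + e) : Fin (m + 2) → ℝ) j) =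
        ∑ j, φ (s j) + expShift φ (s (Fin.last m)) := by
      intro s
      simp only [Fin.sum_univ_castSucc (n := m + 1), Fin.snoc_castSucc, Fin.snoc_last, mul_add]
      rw [lintegral_add_left (by fun_prop), lintegral_mul_const _ (by fun_prop),
        lintegral_exp_neg_Ioi_zero, one_mul, expShift]
    simp only [h1]
    have hm : Measurable fun s : Fin (m + 1) → ℝ => ∫⁻ u in Ioc 0 (s (Fin.last m)), φ u :=
      (measurable_primitive hφ).comp (measurable_pi_apply _)
    rw [lintegral_add_left (by fun_prop), ih, ← lintegral_add_left hm]
    refine lintegral_congr_ae ?_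
    filter_upwards [ae_pos_poissonArrivals m] with s hs
    exact (expShift_primitive hφ (hs _).le).symm

/-- Raise `y ≤ exp y` at `y = x / (2 * p)` to the power `p`. -/
theorem rpow_le_mul_exp_half {p x : ℝ} (hp : 0 < p) (hx : 0 ≤ x) :
    x ^ p ≤ (2 * p) ^ p * Real.exp (x / 2) := by
  have h1 : x / (2 * p) ≤ Real.exp (x / (2 * p)) := by
    linarith [Real.add_one_le_exp (x / (2 * p))]
  have h2 := Real.rpow_le_rpow (by positivity) h1 hp.le
  rw [← Real.exp_mul, show x / (2 * p) * p = x / 2 by field_simp,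
    Real.div_rpow hx (by positivity), div_le_iff₀ (by positivity)] at h2
  linarith

theorem lintegral_rpow_poissonArrivals_le (m : ℕ) {p : ℝ} (hp : 0 < p) :
    ∫⁻ s, ENNReal.ofReal (s (Fin.last m) ^ p) ∂(poissonArrivals m) ≤
      ENNReal.ofReal (2 * (2 * p) ^ p * ((m : ℝ) + 1) ^ p) := by
  set k : ℝ := (m : ℝ) + 1 with hk
  have hk1 : 1 ≤ k := by rw [hk]; linarith [(Nat.cast_nonneg m : (0 : ℝ) ≤ m)]
  have hk0 : 0 < k := by linarith
  have hθ : 1 / (2 * k) ≤ 1 / 2 := by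
    apply div_le_div_of_nonneg_left <;> linarith
  -- The exponential moment at `θ = 1 / (2 * k)` is bounded uniformly in `k`: Bernoulli's inequality
  -- gives `(1 - 1 / (2 * k)) ^ k ≥ 1 / 2`.
  have hpow : (1 / (1 - 1 / (2 * k))) ^ (m + 1) ≤ 2 := by
    have h := one_add_mul_le_pow (a := -(1 / (2 * k))) (by linarith) (m + 1)
    have e : 1 + ((m + 1 : ℕ) : ℝ) * -(1 / (2 * k)) = 1 / 2 := by
      push_cast; rw [← hk]; field_simp; norm_num
    rw [e, ← sub_eq_add_neg] at h
    rw [div_pow, one_pow, div_le_iff₀ (by positivity)]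
    linarith
  calc ∫⁻ s, ENNReal.ofReal (s (Fin.last m) ^ p) ∂(poissonArrivals m)
      ≤ ∫⁻ s, ENNReal.ofReal ((2 * p) ^ p * k ^ p) *
          ENNReal.ofReal (Real.exp (1 / (2 * k) * s (Fin.last m))) ∂(poissonArrivals m) := by
        refine lintegral_mono_ae ?_
        filter_upwards [ae_pos_poissonArrivals m] with s hs
        rw [← ENNReal.ofReal_mul (by positivity)]
        refine ENNReal.ofReal_le_ofReal ?_
        have h := rpow_le_mul_exp_half hp (div_nonneg (hs (Fin.last m)).le hk0.le)
        rw [Real.div_rpow (hs _).le hk0.le, div_le_iff₀ (by positivity)] at h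
        calc _ ≤ _ := h
          _ = _ := by
            rw [show s (Fin.last m) / k / 2 = 1 / (2 * k) * s (Fin.last m) by field_simp]; ring
    _ = ENNReal.ofReal ((2 * p) ^ p * k ^ p) *
          ENNReal.ofReal (1 / (1 - 1 / (2 * k))) ^ (m + 1) := by
        rw [lintegral_const_mul _ (by fun_prop), lintegral_exp_poissonArrivals m (by linarith)]
    _ ≤ ENNReal.ofReal ((2 * p) ^ p * k ^ p) * ENNReal.ofReal 2 := by
        rw [← ENNReal.ofReal_pow (by
          exact div_nonneg zero_le_one (by linarith))]
        gcongr
    _ = _ := by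
        rw [← ENNReal.ofReal_mul (by positivity)]
        congr 1; ring

theorem integrable_rpow_poissonArrivals (m : ℕ) {p : ℝ} (hp : 0 < p) :
    Integrable (fun s => s (Fin.last m) ^ p) (poissonArrivals m) := by
  refine ⟨((measurable_pi_apply _).pow_const p).aestronglyMeasurable, ?_⟩
  rw [hasFiniteIntegral_iff_ofReal]
  · exact (lintegral_rpow_poissonArrivals_le m hp).trans_lt ENNReal.ofReal_lt_top
  · filter_upwards [ae_pos_poissonArrivals m] with s hs
    exact Real.rpow_nonneg (hs _).le _

theorem integral_rpow_poissonArrivals_le (m : ℕ) {p : ℝ} (hp : 0 < p) :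
    ∫ s, s (Fin.last m) ^ p ∂(poissonArrivals m) ≤ 2 * (2 * p) ^ p * ((m : ℝ) + 1) ^ p := by
  rw [integral_eq_lintegral_of_nonneg_ae _
    ((measurable_pi_apply _).pow_const p).aestronglyMeasurable]
  · exact ENNReal.toReal_le_of_le_ofReal (by positivity) (lintegral_rpow_poissonArrivals_le m hp)
  · filter_upwards [ae_pos_poissonArrivals m] with s hs
    exact Real.rpow_nonneg (hs _).le _

theorem integrable_last_poissonArrivals (m : ℕ) :
    Integrable (fun s => s (Fin.last m)) (poissonArrivals m) := by
  simpa using integrable_rpow_poissonArrivals m one_pos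

theorem intervalIntegrable_of_bounded {φ : ℝ → ℝ} {M : ℝ} (hφ : Measurable φ)
    (hM : ∀ t, |φ t| ≤ M) (a b : ℝ) : IntervalIntegrable φ volume a b := by
  refine (intervalIntegrable_const (c := M)).mono_fun hφ.aestronglyMeasurable
    (Filter.Eventually.of_forall fun t => ?_)
  simpa using (hM t).trans (le_abs_self M)

theorem continuous_primitive_of_bounded {φ : ℝ → ℝ} {M : ℝ} (hφ : Measurable φ)
    (hM : ∀ t, |φ t| ≤ M) : Continuous fun t => ∫ u in (0 : ℝ)..t, φ u :=
  intervalIntegral.continuous_primitive (fun a b => intervalIntegrable_of_bounded hφ hM a b) 0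

theorem abs_primitive_le {φ : ℝ → ℝ} {M : ℝ} (hM : ∀ t, |φ t| ≤ M) {t : ℝ} (ht : 0 ≤ t) :
    |∫ u in (0 : ℝ)..t, φ u| ≤ M * t := by
  have := intervalIntegral.norm_integral_le_of_norm_le_const (a := 0) (b := t) (f := φ) (C := M)
    (fun u _ => hM u)
  simpa [abs_of_nonneg ht] using this

theorem integrable_sum_poissonArrivals (m : ℕ) {φ : ℝ → ℝ} {M : ℝ} (hφ : Measurable φ)
    (hM : ∀ t, |φ t| ≤ M) : Integrable (fun s => ∑ j, φ (s j)) (poissonArrivals m) := by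
  refine integrable_finsetSum _ fun j _ => Integrable.of_bound (C := M)
    (hφ.comp (measurable_pi_apply j)).aestronglyMeasurable
    (Filter.Eventually.of_forall fun s => hM _)

theorem integrable_primitive_poissonArrivals (m : ℕ) {φ : ℝ → ℝ} {M : ℝ} (hφ : Measurable φ)
    (hM : ∀ t, |φ t| ≤ M) :
    Integrable (fun s => ∫ u in (0 : ℝ)..(s (Fin.last m)), φ u) (poissonArrivals m) := by
  refine ((integrable_last_poissonArrivals m).const_mul M).mono'
    ((continuous_primitive_of_bounded hφ hM).measurable.comp
      (measurable_pi_apply _)).aestronglyMeasurable ?_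
  filter_upwards [ae_pos_poissonArrivals m] with s hs
  exact abs_primitive_le hM (hs _).le

/-- Adding `M` makes the integrand nonnegative, so the `lintegral` form of Campbell's formula
applies. The `M` terms are kept because the case `φ = 0`, `M = 1` yields the mean of the last
arrival, after which they cancel. -/
theorem integral_sum_add_const_poissonArrivals (m : ℕ) {φ : ℝ → ℝ} {M : ℝ} (hφ : Measurable φ)
    (hM : ∀ t, |φ t| ≤ M) :
    ∫ s, ∑ j, φ (s j) ∂(poissonArrivals m) + (m + 1) * M =
      ∫ s, (∫ u in (0 : ℝ)..(s (Fin.last m)), φ u) ∂(poissonArrivals m) +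
        M * ∫ s, s (Fin.last m) ∂(poissonArrivals m) := by
  have hpos : ∀ t, 0 ≤ φ t + M := fun t => by linarith [neg_le_of_abs_le (hM t)]
  have h := lintegral_sum_poissonArrivals m (φ := fun t => ENNReal.ofReal (φ t + M))
    (by fun_prop)
  have i1 := integrable_sum_poissonArrivals m hφ hM
  have i2 := integrable_primitive_poissonArrivals m hφ hM
  have i3 := (integrable_last_poissonArrivals m).const_mul M
  have e1 : ∀ s : Fin (m + 1) → ℝ, ∑ j, ENNReal.ofReal (φ (s j) + M) =
      ENNReal.ofReal (∑ j, φ (s j) + (m + 1) * M) := by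
    intro s
    rw [← ENNReal.ofReal_sum_of_nonneg fun _ _ => hpos _, Finset.sum_add_distrib]
    simp
  have e2 : ∀ t : ℝ, 0 < t → ∫⁻ u in Ioc 0 t, ENNReal.ofReal (φ u + M) =
      ENNReal.ofReal ((∫ u in (0 : ℝ)..t, φ u) + M * t) := by
    intro t ht
    have hi := intervalIntegrable_of_bounded hφ hM 0 t
    have hi' : IntervalIntegrable (fun u => φ u + M) volume 0 t :=
      hi.add intervalIntegrable_const
    rw [← ofReal_integral_eq_lintegral_ofReal
      ((intervalIntegrable_iff_integrableOn_Ioc_of_le ht.le).1 hi')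
      (Filter.Eventually.of_forall hpos), ← intervalIntegral.integral_of_le ht.le,
      intervalIntegral.integral_add hi intervalIntegrable_const]
    congr 2
    simp [mul_comm]
  simp only [e1] at h
  have e3 : ∫⁻ s, (∫⁻ u in Ioc 0 (s (Fin.last m)), ENNReal.ofReal (φ u + M))
      ∂(poissonArrivals m) = ∫⁻ s, ENNReal.ofReal
        ((∫ u in (0 : ℝ)..(s (Fin.last m)), φ u) + M * s (Fin.last m)) ∂(poissonArrivals m) := by
    refine lintegral_congr_ae ?_
    filter_upwards [ae_pos_poissonArrivals m] with s hs using e2 _ (hs _)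
  rw [e3, ← ofReal_integral_eq_lintegral_ofReal (by exact i1.add (integrable_const _)),
    ← ofReal_integral_eq_lintegral_ofReal (by exact i2.add i3)] at h
  · have n1 : ∀ s : Fin (m + 1) → ℝ, 0 ≤ ∑ j, φ (s j) + (m + 1) * M := by
      intro s
      have := Finset.sum_nonneg fun j (_ : j ∈ Finset.univ) => hpos (s j)
      rw [Finset.sum_add_distrib] at this
      simpa using this
    have n2 : ∀ᵐ s ∂(poissonArrivals m),
        0 ≤ (∫ u in (0 : ℝ)..(s (Fin.last m)), φ u) + M * s (Fin.last m) := by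
      filter_upwards [ae_pos_poissonArrivals m] with s hs
      linarith [neg_le_of_abs_le (abs_primitive_le hM (hs (Fin.last m)).le)]
    rw [ENNReal.ofReal_eq_ofReal_iff (integral_nonneg n1) (integral_nonneg_of_ae n2)] at h
    rw [integral_add i1 (integrable_const _), integral_add i2 i3, integral_const_mul] at h
    simpa [integral_const_mul] using h
  · filter_upwards [ae_pos_poissonArrivals m] with s hs
    have := neg_le_of_abs_le (abs_primitive_le hM (hs (Fin.last m)).le)
    simp only [Pi.zero_apply]
    linarith
  · refine Filter.Eventually.of_forall fun s => ?_
    have := Finset.sum_nonneg fun j (_ : j ∈ Finset.univ) => hpos (s j)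
    rw [Finset.sum_add_distrib] at this
    simpa using this

theorem integral_last_poissonArrivals (m : ℕ) :
    ∫ s, s (Fin.last m) ∂(poissonArrivals m) = m + 1 := by
  have := integral_sum_add_const_poissonArrivals m (φ := fun _ => 0) (M := 1) measurable_const
    (by simp)
  simpa using this.symm

theorem integral_sum_poissonArrivals (m : ℕ) {φ : ℝ → ℝ} {M : ℝ} (hφ : Measurable φ)
    (hM : ∀ t, |φ t| ≤ M) :
    ∫ s, ∑ j, φ (s j) ∂(poissonArrivals m) =
      ∫ s, (∫ u in (0 : ℝ)..(s (Fin.last m)), φ u) ∂(poissonArrivals m) := by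
  have := integral_sum_add_const_poissonArrivals m hφ hM
  rw [integral_last_poissonArrivals] at this
  linarith

/-! ### Time change and the likelihood ratio of inhomogeneous arrivals. -/

/-- The cumulative intensity of a Poisson process with intensity `exp ∘ φ`. -/
def timeChange (φ : ℝ → ℝ) (s : ℝ) : ℝ := ∫ t in (0 : ℝ)..s, Real.exp (φ t)

section TimeChange

variable {φ : ℝ → ℝ} {M : ℝ}

theorem abs_exp_le (hM : ∀ t, |φ t| ≤ M) (t : ℝ) : |Real.exp (φ t)| ≤ Real.exp M := by
  rw [abs_of_pos (Real.exp_pos _)]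
  exact Real.exp_le_exp.2 ((le_abs_self _).trans (hM t))

theorem intervalIntegrable_exp (hφ : Measurable φ) (hM : ∀ t, |φ t| ≤ M) (a b : ℝ) :
    IntervalIntegrable (fun t => Real.exp (φ t)) volume a b :=
  intervalIntegrable_of_bounded hφ.exp (abs_exp_le hM) a b

theorem timeChange_sub (hφ : Measurable φ) (hM : ∀ t, |φ t| ≤ M) (a b : ℝ) :
    timeChange φ b - timeChange φ a = ∫ t in a..b, Real.exp (φ t) :=
  intervalIntegral.integral_interval_sub_left (intervalIntegrable_exp hφ hM _ _)
    (intervalIntegrable_exp hφ hM _ _)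

theorem timeChange_zero : timeChange φ 0 = 0 := by simp [timeChange]

theorem le_timeChange_sub (hφ : Measurable φ) (hM : ∀ t, |φ t| ≤ M) {a b : ℝ} (hab : a ≤ b) :
    Real.exp (-M) * (b - a) ≤ timeChange φ b - timeChange φ a := by
  rw [timeChange_sub hφ hM]
  have := intervalIntegral.integral_mono_on hab (intervalIntegrable_const (c := Real.exp (-M)))
    (intervalIntegrable_exp hφ hM a b)
    (fun t _ => Real.exp_le_exp.2 (neg_le_of_abs_le (hM t)))
  simpa [mul_comm] using this

theorem strictMono_timeChange (hφ : Measurable φ) (hM : ∀ t, |φ t| ≤ M) :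
    StrictMono (timeChange φ) := by
  intro a b hab
  have h1 := le_timeChange_sub hφ hM hab.le
  have h2 := mul_pos (Real.exp_pos (-M)) (sub_pos.2 hab)
  linarith

theorem continuous_timeChange (hφ : Measurable φ) (hM : ∀ t, |φ t| ≤ M) :
    Continuous (timeChange φ) :=
  continuous_primitive_of_bounded hφ.exp (abs_exp_le hM)

theorem surjective_timeChange (hφ : Measurable φ) (hM : ∀ t, |φ t| ≤ M) :
    Function.Surjective (timeChange φ) := by
  have hc := Real.exp_pos (-M)
  refine (continuous_timeChange hφ hM).surjective ?_ ?_
  · refine Filter.tendsto_atTop_mono' _ ?_ (Filter.tendsto_id.const_mul_atTop hc)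
    filter_upwards [Filter.eventually_ge_atTop 0] with t ht
    have := le_timeChange_sub hφ hM ht
    rw [timeChange_zero] at this
    simpa using this
  · refine Filter.tendsto_atBot_mono' _ ?_ (Filter.tendsto_id.const_mul_atBot hc)
    filter_upwards [Filter.eventually_le_atBot 0] with t ht
    have := le_timeChange_sub hφ hM ht
    rw [timeChange_zero] at this
    simp only [id]
    linarith

/-- The time change is an increasing bijection of the line whose increments are the integrals of
`exp ∘ φ`; equality of the two measures is tested on intervals with rational endpoints. -/
theorem map_timeChange (hφ : Measurable φ) (hM : ∀ t, |φ t| ≤ M) :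
    (volume.withDensity fun t => ENNReal.ofReal (Real.exp (φ t))).map (timeChange φ) =
      volume := by
  have hcont := continuous_timeChange hφ hM
  have hmono := strictMono_timeChange hφ hM
  refine (Real.measure_ext_Ioo_rat fun a b => Eq.symm ?_).symm
  obtain ⟨a', ha⟩ := surjective_timeChange hφ hM a
  obtain ⟨b', hb⟩ := surjective_timeChange hφ hM b
  have hpre : timeChange φ ⁻¹' Ioo (a : ℝ) b = Ioo a' b' := by
    ext t
    simp only [mem_preimage, mem_Ioo, ← ha, ← hb, hmono.lt_iff_lt]
  rw [Measure.map_apply hcont.measurable measurableSet_Ioo, hpre,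
    withDensity_apply _ measurableSet_Ioo, Real.volume_Ioo]
  rcases le_total b' a' with h | h
  · have h' : (b : ℝ) ≤ a := by rw [← ha, ← hb]; exact hmono.monotone h
    rw [Ioo_eq_empty (not_lt.2 h), ENNReal.ofReal_of_nonpos (by linarith)]
    simp
  · rw [setLIntegral_congr Ioo_ae_eq_Ioc, ← ofReal_integral_eq_lintegral_ofReal
      ((intervalIntegrable_iff_integrableOn_Ioc_of_le h).1 (intervalIntegrable_exp hφ hM _ _))
      (Filter.Eventually.of_forall fun _ => (Real.exp_pos _).le),
      ← intervalIntegral.integral_of_le h, ← timeChange_sub hφ hM, ha, hb]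

theorem map_timeChange_Ioi (hφ : Measurable φ) (hM : ∀ t, |φ t| ≤ M) :
    ((volume.restrict (Ioi 0)).withDensity fun t => ENNReal.ofReal (Real.exp (φ t))).map
      (timeChange φ) = volume.restrict (Ioi 0) := by
  have hpre : timeChange φ ⁻¹' Ioi 0 = Ioi 0 := by
    ext t
    have := (strictMono_timeChange hφ hM).lt_iff_lt (a := 0) (b := t)
    rwa [timeChange_zero] at this
  conv_rhs => rw [← map_timeChange hφ hM]
  rw [Measure.restrict_map (continuous_timeChange hφ hM).measurable measurableSet_Ioi, hpre,
    restrict_withDensity measurableSet_Ioi]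

/-- The negative log-likelihood ratio of the inhomogeneous to the homogeneous arrivals. -/
def logRatio (m : ℕ) (φ : ℝ → ℝ) (s : Fin (m + 1) → ℝ) : ℝ :=
  timeChange φ (s (Fin.last m)) - s (Fin.last m) - ∑ j, φ (s j)

theorem measurable_logRatio (m : ℕ) (hφ : Measurable φ) (hM : ∀ t, |φ t| ≤ M) :
    Measurable (logRatio m φ) := by
  have := (continuous_timeChange hφ hM).measurable
  unfold logRatio
  fun_prop

/-- Multiplying the arrival density by `exp (-logRatio)` gives `exp (-Θ (s_m)) * ∏ exp (φ (s_j))` on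
increasing sequences, and the product is the Jacobian of `Θ` in each coordinate. So under the
reweighted law the points `Θ (s_j)` are again unit rate arrivals. -/
theorem lintegral_exp_logRatio_mul (m : ℕ) (hφ : Measurable φ) (hM : ∀ t, |φ t| ≤ M)
    {F : (Fin (m + 1) → ℝ) → ℝ≥0∞} (hF : Measurable F) :
    ∫⁻ s, ENNReal.ofReal (Real.exp (-logRatio m φ s)) * F (fun j => timeChange φ (s j))
      ∂(poissonArrivals m) = ∫⁻ s, F s ∂(poissonArrivals m) := by
  have hΘ := (continuous_timeChange hφ hM).measurable
  have hmono := strictMono_timeChange hφ hM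
  have hΘ' : Measurable fun (s : Fin (m + 1) → ℝ) j => timeChange φ (s j) := by fun_prop
  have hz := measurable_logRatio m hφ hM
  have hsf : SigmaFinite ((volume.restrict (Ioi (0 : ℝ))).withDensity
      fun t => ENNReal.ofReal (Real.exp (φ t))) := SigmaFinite.withDensity_ofReal _
  have hsf' : SigmaFinite (((volume.restrict (Ioi (0 : ℝ))).withDensity
      fun t => ENNReal.ofReal (Real.exp (φ t))).map (timeChange φ)) := by
    rw [map_timeChange_Ioi hφ hM]; infer_instance
  have hG : Measurable ({s : Fin (m + 1) → ℝ | StrictMono s}.indicator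
      (fun s => ENNReal.ofReal (Real.exp (-(s (Fin.last m)))) * F s)) :=
    Measurable.indicator (by fun_prop) (measurableSet_strictMono _)
  have hpi : Measure.pi (fun _ : Fin (m + 1) => volume.restrict (Ioi (0 : ℝ))) =
      ((Measure.pi (fun _ : Fin (m + 1) => volume.restrict (Ioi (0 : ℝ)))).withDensity
        (fun s => ∏ j, ENNReal.ofReal (Real.exp (φ (s j))))).map
        (fun s j => timeChange φ (s j)) := by
    rw [← pi_withDensity (fun _ : Fin (m + 1) => volume.restrict (Ioi (0 : ℝ)))
      (f := fun _ t => ENNReal.ofReal (Real.exp (φ t))) (fun _ => by fun_prop),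
      Measure.pi_map_pi (fun _ => hΘ.aemeasurable)]
    simp only [map_timeChange_Ioi hφ hM]
  rw [lintegral_poissonArrivals m (by fun_prop), lintegral_poissonArrivals m hF]
  conv_rhs => rw [hpi]
  rw [lintegral_map hG hΘ', lintegral_withDensity_eq_lintegral_mul _ (by fun_prop)
    (by exact hG.comp hΘ')]
  refine lintegral_congr fun s => ?_
  have hiff : StrictMono (fun j => timeChange φ (s j)) ↔ StrictMono s :=
    ⟨fun h i j hij => hmono.lt_iff_lt.1 (h hij), fun h => hmono.comp h⟩
  by_cases hs : StrictMono s
  · simp only [Pi.mul_apply, indicator, mem_ofPred_eq, hiff, hs, if_true]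
    rw [← ENNReal.ofReal_prod_of_nonneg (fun _ _ => (Real.exp_pos _).le), ← Real.exp_sum,
      ← mul_assoc, ← mul_assoc, ← ENNReal.ofReal_mul (Real.exp_pos _).le,
      ← ENNReal.ofReal_mul (Real.exp_pos _).le, ← Real.exp_add, ← Real.exp_add, logRatio]
    congr 3
    ring
  · simp [indicator, hiff, hs]

end TimeChange

/-! ### Elementary inequalities for the two likelihood comparisons. -/

theorem abs_exp_sub_one_sub_id_le_sq {x M : ℝ} (hx : |x| ≤ M) :
    |Real.exp x - 1 - x| ≤ Real.exp M * x ^ 2 := by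
  have h0 : 0 ≤ Real.exp x - 1 - x := by linarith [Real.add_one_le_exp x]
  have hM : 1 ≤ Real.exp M := Real.one_le_exp ((abs_nonneg x).trans hx)
  have h1 : Real.exp x - 1 ≤ x * Real.exp x := by
    have h := Real.add_one_le_exp (-x)
    have h' := mul_le_mul_of_nonneg_right h (Real.exp_pos x).le
    rw [← Real.exp_add, neg_add_cancel, Real.exp_zero] at h'
    linarith
  rw [abs_of_nonneg h0]
  rcases le_total 0 x with hx0 | hx0
  · have h2 : Real.exp x ≤ Real.exp M := Real.exp_le_exp.2 ((le_abs_self x).trans hx)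
    calc Real.exp x - 1 - x ≤ x * (Real.exp x - 1) := by linarith
      _ ≤ x * (x * Real.exp x) := mul_le_mul_of_nonneg_left h1 hx0
      _ = Real.exp x * x ^ 2 := by ring
      _ ≤ _ := by gcongr
  · calc Real.exp x - 1 - x ≤ x * (Real.exp x - 1) := by linarith
      _ ≤ x * x := mul_le_mul_of_nonpos_left (by linarith [Real.add_one_le_exp x]) hx0
      _ = 1 * x ^ 2 := by ring
      _ ≤ _ := by gcongr

/-- A pointwise form of the bound of total variation by the root of the divergence. With `r = exp
(-z / 2)` one has `1 - r ^ 2 ≤ 2 * (1 - r) ≤ l + (1 - r) ^ 2 / l`, and `(1 - r) ^ 2 ≤ r ^ 2 - 1 + z`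
because `2 * (1 - r) ≤ z`. The free parameter `l` is optimized after integration. -/
theorem one_le_exp_neg_add {z l : ℝ} (hl : 0 < l) :
    1 ≤ Real.exp (-z) + (l + (Real.exp (-z) - 1 + z) / l) := by
  set r := Real.exp (-z / 2) with hr
  have hr0 : 0 < r := Real.exp_pos _
  have hr2 : Real.exp (-z) = r ^ 2 := by rw [hr, ← Real.exp_nat_mul]; congr 1; push_cast; ring
  have hz : 2 * (1 - r) ≤ z := by linarith [Real.add_one_le_exp (-z / 2)]
  rw [hr2]
  have h1 : (1 - r) ^ 2 / l ≤ (r ^ 2 - 1 + z) / l := by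
    gcongr
    nlinarith
  have h2 : 1 - r ^ 2 ≤ l + (1 - r) ^ 2 / l := by
    have : l + (1 - r) ^ 2 / l - 2 * (1 - r) = (l - (1 - r)) ^ 2 / l := by field_simp; ring
    have : 0 ≤ (l - (1 - r)) ^ 2 / l := by positivity
    nlinarith [sq_nonneg (1 - r)]
  linarith

/-- A Stirling-type bound without Stirling: passing from `k` to `k + 1` costs `(1 + 1 / j) ^ j ≤ e`
with `j = n - k - 1`. For `j = 0` the convention `0 ^ 0 = 1` is used. -/
theorem pow_self_le_descFactorial_mul (n k : ℕ) (hk : k ≤ n) :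
    (n : ℝ) ^ n ≤ n.descFactorial k * Real.exp k * ((n - k : ℕ) : ℝ) ^ (n - k) := by
  induction k with
  | zero => simp
  | succ k ih =>
    obtain ⟨j, rfl⟩ : ∃ j, n = k + 1 + j := ⟨n - (k + 1), by omega⟩
    have h := ih (by omega)
    rw [show k + 1 + j - k = j + 1 by omega] at h
    rw [show k + 1 + j - (k + 1) = j by omega, Nat.descFactorial_succ,
      show k + 1 + j - k = j + 1 by omega]
    refine h.trans ?_
    have key : ((j + 1 : ℕ) : ℝ) ^ j ≤ Real.exp 1 * (j : ℝ) ^ j := by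
      rcases Nat.eq_zero_or_pos j with rfl | hj
      · simp
      · have hj' : (0 : ℝ) < j := by exact_mod_cast hj
        have h1 : ((j + 1 : ℕ) : ℝ) ≤ Real.exp (1 / j) * j := by
          have := Real.add_one_le_exp (1 / (j : ℝ))
          have := mul_le_mul_of_nonneg_right this hj'.le
          calc ((j + 1 : ℕ) : ℝ) = (1 / (j : ℝ) + 1) * j := by push_cast; field_simp; ring
            _ ≤ _ := this
        calc ((j + 1 : ℕ) : ℝ) ^ j ≤ (Real.exp (1 / j) * j) ^ j := by gcongr
          _ = Real.exp 1 * (j : ℝ) ^ j := by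
            rw [mul_pow, ← Real.exp_nat_mul]; congr 2; field_simp
    calc ((k + 1 + j).descFactorial k : ℝ) * Real.exp k * ((j + 1 : ℕ) : ℝ) ^ (j + 1)
        = ((k + 1 + j).descFactorial k : ℝ) * Real.exp k * ((j + 1 : ℕ) : ℝ) *
            ((j + 1 : ℕ) : ℝ) ^ j := by ring
      _ ≤ ((k + 1 + j).descFactorial k : ℝ) * Real.exp k * ((j + 1 : ℕ) : ℝ) *
            (Real.exp 1 * (j : ℝ) ^ j) := by gcongr
      _ = _ := by push_cast; rw [Real.exp_add]; ring

/-- Follows from `log (1 - u) ≥ 1 - 1 / (1 - u)`. Negative `u` must be allowed, since it stands for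
the deviation `(x - k) / (n - k)` of either sign. -/
theorem exp_le_one_sub {u : ℝ} (hu : u ≤ 1 / 2) : Real.exp (-u - 2 * u ^ 2) ≤ 1 - u := by
  have hpos : 0 < 1 - u := by linarith
  rw [← Real.le_log_iff_exp_le hpos]
  refine le_trans ?_ (Real.one_sub_inv_le_log_of_pos hpos)
  have : 1 - (1 - u)⁻¹ - (-u - 2 * u ^ 2) = u ^ 2 * (1 - 2 * u) / (1 - u) := by
    field_simp; ring
  have : 0 ≤ u ^ 2 * (1 - 2 * u) / (1 - u) :=
    div_nonneg (mul_nonneg (sq_nonneg _) (by linarith)) hpos.le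
  linarith

/-- Comparison of the binomial and the Poisson likelihoods. -/
theorem one_sub_le_binomial_ratio {n k : ℕ} (hn : 0 < n) (hk : (k : ℝ) ≤ n / 2) {x : ℝ}
    (hx : x ≤ n / 2) :
    1 - 4 * (x - k) ^ 2 / n ≤
      n.descFactorial k / (n : ℝ) ^ k * Real.exp x * (1 - x / n) ^ (n - k) := by
  have hn' : (0 : ℝ) < n := by exact_mod_cast hn
  have hkn : k ≤ n := by
    have : (k : ℝ) ≤ n := by linarith
    exact_mod_cast this
  obtain ⟨N, rfl⟩ := Nat.exists_eq_add_of_le hkn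
  have hN : ((k + N : ℕ) : ℝ) / 2 ≤ N := by push_cast at hk ⊢; linarith
  have hN' : (0 : ℝ) < N := by linarith
  have h1 := pow_self_le_descFactorial_mul (k + N) k hkn
  rw [Nat.add_sub_cancel_left] at h1 ⊢
  set n : ℝ := ((k + N : ℕ) : ℝ) with hndef
  have hnk : n = k + N := by rw [hndef]; push_cast; ring
  have h2 : n ^ N / (Real.exp k * (N : ℝ) ^ N) ≤ (k + N).descFactorial k / n ^ k := by
    rw [div_le_div_iff₀ (by positivity) (by positivity), ← pow_add, add_comm N k]
    linarith
  have hu : (x - k) / N ≤ 1 / 2 := by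
    rw [div_le_iff₀ hN']; linarith
  have h3 : Real.exp (-(x - k) - 2 * (x - k) ^ 2 / N) ≤ ((n - x) / N) ^ N := by
    have e := exp_le_one_sub hu
    calc Real.exp (-(x - k) - 2 * (x - k) ^ 2 / N)
        = Real.exp (-((x - k) / N) - 2 * ((x - k) / N) ^ 2) ^ N := by
          rw [← Real.exp_nat_mul]; congr 1; field_simp
      _ ≤ (1 - (x - k) / N) ^ N := by gcongr
      _ = ((n - x) / N) ^ N := by congr 1; rw [hnk]; field_simp; ring
  have hxn : 0 ≤ 1 - x / n := by
    rw [sub_nonneg, div_le_one hn']; linarith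
  -- The linear exponents `x - k` and `-(x - k)` cancel, so only the quadratic error remains; `N ≥ n
  -- / 2` turns `2 / N` into `4 / n`.
  calc 1 - 4 * (x - k) ^ 2 / n ≤ 1 - 2 * (x - k) ^ 2 / N := by
        have : 2 * (x - k) ^ 2 / N ≤ 4 * (x - k) ^ 2 / n := by
          rw [div_le_div_iff₀ hN' hn']
          nlinarith [sq_nonneg (x - k)]
        linarith
    _ ≤ Real.exp (-(2 * (x - k) ^ 2 / N)) := by
        linarith [Real.add_one_le_exp (-(2 * (x - k) ^ 2 / N))]
    _ = Real.exp (x - k) * Real.exp (-(x - k) - 2 * (x - k) ^ 2 / N) := by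
        rw [← Real.exp_add]; congr 1; ring
    _ ≤ Real.exp (x - k) * ((n - x) / N) ^ N := by gcongr
    _ = n ^ N / (Real.exp k * (N : ℝ) ^ N) * Real.exp x * (1 - x / n) ^ N := by
        rw [Real.exp_sub, div_pow, show 1 - x / n = (n - x) / n by field_simp, div_pow]
        field_simp
    _ ≤ _ := by gcongr

/-! ### Entropy bound, and passage from the Poisson to the binomial likelihood. -/

section

variable {φ : ℝ → ℝ} {M : ℝ}

/-- The left side is the integral of `exp φ - 1 - φ`, which on `(0, t]` is at most `exp M * (a * t ^
δ) ^ 2`. -/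
theorem abs_timeChange_sub_le (hφ : Measurable φ) (hM : ∀ t, |φ t| ≤ M) {a δ : ℝ} (hδ : 0 < δ)
    (hφa : ∀ t, 0 < t → |φ t| ≤ a * t ^ δ) {t : ℝ} (ht : 0 < t) :
    timeChange φ t - t - ∫ u in (0 : ℝ)..t, φ u ≤ Real.exp M * a ^ 2 * t ^ (1 + 2 * δ) := by
  have h1 : timeChange φ t - t - ∫ u in (0 : ℝ)..t, φ u =
      ∫ u in (0 : ℝ)..t, (Real.exp (φ u) - 1 - φ u) := by
    rw [intervalIntegral.integral_sub
      ((intervalIntegrable_exp hφ hM 0 t).sub intervalIntegrable_const)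
      (intervalIntegrable_of_bounded hφ hM 0 t), intervalIntegral.integral_sub
      (intervalIntegrable_exp hφ hM 0 t) intervalIntegrable_const]
    simp [timeChange]
  rw [h1]
  have h2 := intervalIntegral.norm_integral_le_of_norm_le_const (a := 0) (b := t)
    (f := fun u => Real.exp (φ u) - 1 - φ u) (C := Real.exp M * (a * t ^ δ) ^ 2) (by
      intro u hu
      rw [uIoc_of_le ht.le] at hu
      have ha : 0 ≤ a := by
        have := (abs_nonneg _).trans (hφa 1 one_pos)
        simpa using this
      have h3 : |φ u| ≤ a * t ^ δ := (hφa u hu.1).trans (by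
        have := Real.rpow_le_rpow hu.1.le hu.2 hδ.le
        gcongr)
      refine (abs_exp_sub_one_sub_id_le_sq (hM u)).trans ?_
      gcongr Real.exp M * ?_
      rw [← sq_abs (φ u)]
      gcongr)
  refine (le_abs_self _).trans (h2.trans_eq ?_)
  rw [sub_zero, abs_of_pos ht, mul_pow, ← Real.rpow_natCast (t ^ δ) 2, ← Real.rpow_mul ht.le,
    Real.rpow_add ht, Real.rpow_one, mul_comm 2 δ]
  push_cast
  ring

/-- The mean of `logRatio` is a Kullback–Leibler divergence. Campbell's formula replaces the sum of
`φ` by its integral, so the first order terms cancel and the bound is quadratic in `a`. -/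
theorem integral_logRatio_le (m : ℕ) (hφ : Measurable φ) (hM : ∀ t, |φ t| ≤ M) {a δ : ℝ}
    (hδ : 0 < δ) (hφa : ∀ t, 0 < t → |φ t| ≤ a * t ^ δ) :
    Integrable (logRatio m φ) (poissonArrivals m) ∧
    ∫ s, logRatio m φ s ∂(poissonArrivals m) ≤ Real.exp M * a ^ 2 *
      (2 * (2 * (1 + 2 * δ)) ^ (1 + 2 * δ) * ((m : ℝ) + 1) ^ (1 + 2 * δ)) := by
  have i1 := integrable_sum_poissonArrivals m hφ hM
  have i2 := integrable_primitive_poissonArrivals m hφ hM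
  have i3 : Integrable (fun s => timeChange φ (s (Fin.last m))) (poissonArrivals m) :=
    integrable_primitive_poissonArrivals m hφ.exp (abs_exp_le hM)
  have i4 := integrable_last_poissonArrivals m
  have hi : Integrable (logRatio m φ) (poissonArrivals m) := (i3.sub i4).sub i1
  have hp : 0 < 1 + 2 * δ := by linarith
  refine ⟨hi, ?_⟩
  have i5 : Integrable (fun s => timeChange φ (s (Fin.last m)) - s (Fin.last m) -
      ∫ u in (0 : ℝ)..(s (Fin.last m)), φ u) (poissonArrivals m) := (i3.sub i4).sub i2
  calc ∫ s, logRatio m φ s ∂(poissonArrivals m)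
      = ∫ s, (timeChange φ (s (Fin.last m)) - s (Fin.last m) -
          ∫ u in (0 : ℝ)..(s (Fin.last m)), φ u) ∂(poissonArrivals m) := by
        unfold logRatio
        rw [integral_sub (by exact i3.sub i4) i1, integral_sub (by exact i3.sub i4) i2,
          integral_sum_poissonArrivals m hφ hM]
    _ ≤ ∫ s, Real.exp M * a ^ 2 * s (Fin.last m) ^ (1 + 2 * δ) ∂(poissonArrivals m) := by
        refine integral_mono_ae i5 ((integrable_rpow_poissonArrivals m hp).const_mul _) ?_
        filter_upwards [ae_pos_poissonArrivals m] with s hs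
        exact abs_timeChange_sub_le hφ hM hδ hφa (hs _)
    _ ≤ _ := by
        rw [integral_const_mul]
        gcongr
        exact integral_rpow_poissonArrivals_le m hp

theorem integral_exp_neg_logRatio (m : ℕ) (hφ : Measurable φ) (hM : ∀ t, |φ t| ≤ M) :
    Integrable (fun s => Real.exp (-logRatio m φ s)) (poissonArrivals m) ∧
    ∫ s, Real.exp (-logRatio m φ s) ∂(poissonArrivals m) = 1 := by
  have hz := measurable_logRatio m hφ hM
  have h := lintegral_exp_logRatio_mul m hφ hM (F := fun _ => 1) measurable_const
  simp only [mul_one, lintegral_one, measure_univ] at h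
  constructor
  · refine ⟨by fun_prop, ?_⟩
    rw [hasFiniteIntegral_iff_ofReal (Filter.Eventually.of_forall fun _ => (Real.exp_pos _).le),
      h]
    exact ENNReal.one_lt_top
  · rw [integral_eq_lintegral_of_nonneg_ae
      (Filter.Eventually.of_forall fun _ => (Real.exp_pos _).le) (by fun_prop), h]
    simp

/-- The entropy bound for changing the intensity of a Poisson process. -/
theorem poissonArrivals_le_setLIntegral_exp (m : ℕ) (hφ : Measurable φ) (hM : ∀ t, |φ t| ≤ M)
    {a δ : ℝ} (hδ : 0 < δ) (hφa : ∀ t, 0 < t → |φ t| ≤ a * t ^ δ) {l : ℝ} (hl : 0 < l)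
    (S : Set (Fin (m + 1) → ℝ)) :
    poissonArrivals m S ≤
      ∫⁻ s in S, ENNReal.ofReal (Real.exp (-logRatio m φ s)) ∂(poissonArrivals m) +
        ENNReal.ofReal (l + Real.exp M * a ^ 2 * (2 * (2 * (1 + 2 * δ)) ^ (1 + 2 * δ) *
          ((m : ℝ) + 1) ^ (1 + 2 * δ)) / l) := by
  have hz := measurable_logRatio m hφ hM
  obtain ⟨i1, h1⟩ := integral_logRatio_le m hφ hM hδ hφa
  obtain ⟨i2, h2⟩ := integral_exp_neg_logRatio m hφ hM
  have i3 : Integrable (fun s => l + (Real.exp (-logRatio m φ s) - 1 + logRatio m φ s) / l)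
      (poissonArrivals m) :=
    (integrable_const _).add (((i2.sub (integrable_const _)).add i1).div_const _)
  have hnn : ∀ s, 0 ≤ l + (Real.exp (-logRatio m φ s) - 1 + logRatio m φ s) / l := fun s =>
    add_nonneg hl.le (div_nonneg (by linarith [Real.add_one_le_exp (-logRatio m φ s)]) hl.le)
  calc poissonArrivals m S = ∫⁻ s in S, 1 ∂(poissonArrivals m) := by simp
    _ ≤ ∫⁻ s in S, (ENNReal.ofReal (Real.exp (-logRatio m φ s)) +
          ENNReal.ofReal (l + (Real.exp (-logRatio m φ s) - 1 + logRatio m φ s) / l))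
          ∂(poissonArrivals m) := by
        refine lintegral_mono fun s => ?_
        rw [← ENNReal.ofReal_add (Real.exp_pos _).le (hnn s), ← ENNReal.ofReal_one]
        exact ENNReal.ofReal_le_ofReal (one_le_exp_neg_add hl)
    _ ≤ _ := by
        rw [lintegral_add_left (by fun_prop)]
        refine add_le_add le_rfl ?_
        -- The error integrand is nonnegative, so it may be integrated over the whole space, where
        -- `exp (-logRatio)` has mean 1 and only `l` plus the divergence over `l` survives.
        refine (setLIntegral_le_lintegral _ _).trans ?_
        rw [← ofReal_integral_eq_lintegral_ofReal i3 (Filter.Eventually.of_forall hnn)]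
        refine ENNReal.ofReal_le_ofReal ?_
        rw [integral_add (integrable_const _)
          (by exact ((i2.sub (integrable_const _)).add i1).div_const _), integral_div,
          integral_add (by exact i2.sub (integrable_const _)) i1,
          integral_sub i2 (integrable_const _), h2]
        simp only [integral_const, probReal_univ, smul_eq_mul, mul_one, one_mul, sub_self,
          zero_add]
        gcongr

/-- A truncated version of the likelihood comparison. Beyond `c * n` one has `x - k ≥ c * n / 2`, so
the quadratic term alone is at least `n ≥ 1`; this is what the factor `1 / c ^ 2` pays for. -/
theorem one_le_binomial_ratio_add {n k : ℕ} (hn : 0 < n) {c : ℝ} (hc : 0 < c) (hc' : c ≤ 1 / 2)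
    (hk : (k : ℝ) ≤ c * n / 2) {x : ℝ} :
    1 ≤ (if x < c * n then
        n.descFactorial k / (n : ℝ) ^ k * Real.exp x * (1 - x / n) ^ (n - k) else 0) +
      4 / c ^ 2 / n * (x - k) ^ 2 := by
  have hn' : (0 : ℝ) < n := by exact_mod_cast hn
  have hcn : c * n ≤ n / 2 := by nlinarith
  have hcn0 : 0 < c * n := by positivity
  split_ifs with h
  · have := one_sub_le_binomial_ratio hn (by linarith : (k : ℝ) ≤ n / 2)
      (by linarith : x ≤ n / 2)
    have h2 : 4 * (x - k) ^ 2 / n ≤ 4 / c ^ 2 / n * (x - k) ^ 2 := by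
      have : 4 * (x - k) ^ 2 / n = 4 / 1 / n * (x - k) ^ 2 := by ring
      rw [this]
      gcongr
      nlinarith
    linarith
  · have h1 : c * n / 2 ≤ x - k := by linarith [not_lt.1 h]
    have hn1 : (1 : ℝ) ≤ n := by exact_mod_cast hn
    rw [zero_add]
    calc (1 : ℝ) ≤ n := hn1
      _ = 4 / c ^ 2 / n * (c * n / 2) ^ 2 := by field_simp; norm_num
      _ ≤ _ := by gcongr

/-- Replacing the Poisson by the binomial likelihood. -/
theorem setLIntegral_exp_le_binomial (m : ℕ) (hφ : Measurable φ) (hM : ∀ t, |φ t| ≤ M)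
    {n : ℕ} (hn : 0 < n) {c : ℝ} (hc : 0 < c) (hc' : c ≤ 1 / 2)
    (hk : ((m + 1 : ℕ) : ℝ) ≤ c * n / 2) {Y : ℝ} (hY : c * n ≤ timeChange φ Y)
    (S : Set (Fin (m + 1) → ℝ)) :
    ∫⁻ s in S, ENNReal.ofReal (Real.exp (-logRatio m φ s)) ∂(poissonArrivals m) ≤
      ∫⁻ s in S ∩ {s | s (Fin.last m) < Y}, ENNReal.ofReal (Real.exp (-logRatio m φ s) *
        (n.descFactorial (m + 1) / (n : ℝ) ^ (m + 1) * Real.exp (timeChange φ (s (Fin.last m))) *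
          (1 - timeChange φ (s (Fin.last m)) / n) ^ (n - (m + 1)))) ∂(poissonArrivals m) +
      ENNReal.ofReal (4 / c ^ 2 * ((m + 1 : ℕ) / n)) := by
  have hz := measurable_logRatio m hφ hM
  have hΘ := (continuous_timeChange hφ hM).measurable
  have hmono := strictMono_timeChange hφ hM
  have hYm : MeasurableSet {s : Fin (m + 1) → ℝ | s (Fin.last m) < Y} :=
    measurableSet_lt (measurable_pi_apply _) measurable_const
  set R : ℝ → ℝ := fun x => n.descFactorial (m + 1) / (n : ℝ) ^ (m + 1) * Real.exp x *
    (1 - x / n) ^ (n - (m + 1)) with hR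
  have hRm : Measurable R := by fun_prop
  have hpt : ∀ s : Fin (m + 1) → ℝ, ENNReal.ofReal (Real.exp (-logRatio m φ s)) ≤
      {s : Fin (m + 1) → ℝ | s (Fin.last m) < Y}.indicator (fun s => ENNReal.ofReal
        (Real.exp (-logRatio m φ s) * R (timeChange φ (s (Fin.last m))))) s +
      ENNReal.ofReal (Real.exp (-logRatio m φ s)) * (ENNReal.ofReal (4 / c ^ 2 / n) *
        ENNReal.ofReal ((timeChange φ (s (Fin.last m)) - ((m + 1 : ℕ) : ℝ)) ^ 2)) := by
    intro s
    have h := one_le_binomial_ratio_add hn hc hc' hk (x := timeChange φ (s (Fin.last m)))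
    set x := timeChange φ (s (Fin.last m))
    have h1 : (1 : ℝ≥0∞) ≤ ENNReal.ofReal (if x < c * n then R x else 0) +
        ENNReal.ofReal (4 / c ^ 2 / n) * ENNReal.ofReal ((x - ((m + 1 : ℕ) : ℝ)) ^ 2) := by
      rw [← ENNReal.ofReal_mul (by positivity), ← ENNReal.ofReal_one]
      exact (ENNReal.ofReal_le_ofReal h).trans ENNReal.ofReal_add_le
    calc ENNReal.ofReal (Real.exp (-logRatio m φ s))
        = ENNReal.ofReal (Real.exp (-logRatio m φ s)) * 1 := (mul_one _).symm
      _ ≤ _ := mul_le_mul_right h1 _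
      _ = _ := mul_add _ _ _
      _ ≤ _ := by
        gcongr ?_ + _
        rw [← ENNReal.ofReal_mul (Real.exp_pos _).le]
        split_ifs with hx
        · rw [indicator_of_mem]
          exact hmono.lt_iff_lt.1 (lt_of_lt_of_le hx hY)
        · simp
  refine (lintegral_mono hpt).trans ?_
  rw [lintegral_add_left (Measurable.indicator (by fun_prop) hYm), lintegral_indicator hYm,
    Measure.restrict_restrict hYm, inter_comm]
  refine add_le_add le_rfl ?_
  refine (setLIntegral_le_lintegral _ _).trans ?_
  -- Under the reweighted law `Θ (s_m)` is distributed as the last of `k = m + 1` unit rate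
  -- arrivals, so its mean square deviation from `k` is exactly `k`.
  rw [lintegral_exp_logRatio_mul m hφ hM (F := fun s => ENNReal.ofReal (4 / c ^ 2 / n) *
    ENNReal.ofReal ((s (Fin.last m) - ((m + 1 : ℕ) : ℝ)) ^ 2)) (by fun_prop),
    lintegral_const_mul _ (by fun_prop), lintegral_sq_poissonArrivals,
    ← ENNReal.ofReal_mul (by positivity)]
  refine ENNReal.ofReal_le_ofReal (le_of_eq ?_)
  push_cast
  ring

/-- The exponentials of `s_m` and `Θ (s_m)` cancel in pairs, and `n ^ (m + 1)` is absorbed as `1 /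
n` in each coordinate. What is left has the shape of the joint density of the `m + 1` smallest of
`n` independent points with density `exp φ / n`. -/
theorem setLIntegral_binomial_eq (m : ℕ) (hφ : Measurable φ) (hM : ∀ t, |φ t| ≤ M)
    {n : ℕ} {S : Set (Fin (m + 1) → ℝ)} (hS : MeasurableSet S) :
    ∫⁻ s in S, ENNReal.ofReal (Real.exp (-logRatio m φ s) *
        (n.descFactorial (m + 1) / (n : ℝ) ^ (m + 1) * Real.exp (timeChange φ (s (Fin.last m))) *
          (1 - timeChange φ (s (Fin.last m)) / n) ^ (n - (m + 1)))) ∂(poissonArrivals m) =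
      n.descFactorial (m + 1) * ∫⁻ s in S ∩ {s | StrictMono s},
        ENNReal.ofReal ((1 - timeChange φ (s (Fin.last m)) / n) ^ (n - (m + 1)))
        ∂(Measure.pi fun _ : Fin (m + 1) => (volume.restrict (Ioi 0)).withDensity
          fun t => ENNReal.ofReal (Real.exp (φ t) / n)) := by
  have hz := measurable_logRatio m hφ hM
  have hΘ := (continuous_timeChange hφ hM).measurable
  have hsf : SigmaFinite ((volume.restrict (Ioi (0 : ℝ))).withDensity
      fun t => ENNReal.ofReal (Real.exp (φ t) / n)) := SigmaFinite.withDensity_ofReal _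
  have hSm := hS.inter (measurableSet_strictMono (m + 1))
  rw [pi_withDensity (fun _ : Fin (m + 1) => volume.restrict (Ioi (0 : ℝ)))
      (f := fun _ t => ENNReal.ofReal (Real.exp (φ t) / n)) (fun _ => by fun_prop),
    ← lintegral_indicator hS, ← lintegral_indicator hSm, lintegral_poissonArrivals m
      (Measurable.indicator (by fun_prop) hS), lintegral_withDensity_eq_lintegral_mul _
      (by fun_prop) (Measurable.indicator (by fun_prop) hSm), ← lintegral_const_mul _ (by
        exact Measurable.mul (by fun_prop) (Measurable.indicator (by fun_prop) hSm))]
  refine lintegral_congr fun s => ?_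
  by_cases h1 : StrictMono s
  · by_cases h2 : s ∈ S
    · have h3 : s ∈ S ∩ {s | StrictMono s} := ⟨h2, h1⟩
      rw [indicator_of_mem (by exact h1), indicator_of_mem h2, Pi.mul_apply,
        indicator_of_mem h3, ← ENNReal.ofReal_prod_of_nonneg (fun _ _ => by positivity),
        ← ENNReal.ofReal_mul (Real.exp_pos _).le, ← ENNReal.ofReal_mul
          (Finset.prod_nonneg fun _ _ => by positivity), ← ENNReal.ofReal_natCast,
        ← ENNReal.ofReal_mul (Nat.cast_nonneg _), Finset.prod_div_distrib, ← Real.exp_sum]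
      congr 1
      simp only [logRatio, Finset.prod_const, Finset.card_univ, Fintype.card_fin]
      rw [show -(timeChange φ (s (Fin.last m)) - s (Fin.last m) - ∑ j, φ (s j)) =
        s (Fin.last m) + ∑ j, φ (s j) + -timeChange φ (s (Fin.last m)) by ring, Real.exp_add,
        Real.exp_add]
      have e1 : Real.exp (-s (Fin.last m)) * Real.exp (s (Fin.last m)) = 1 := by
        rw [← Real.exp_add]; simp
      have e2 : Real.exp (-timeChange φ (s (Fin.last m))) *
          Real.exp (timeChange φ (s (Fin.last m))) = 1 := by
        rw [← Real.exp_add]; simp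
      generalize Real.exp (-s (Fin.last m)) = a1 at *
      generalize Real.exp (s (Fin.last m)) = a2 at *
      generalize Real.exp (-timeChange φ (s (Fin.last m))) = b1 at *
      generalize Real.exp (timeChange φ (s (Fin.last m))) = b2 at *
      generalize (1 - timeChange φ (s (Fin.last m)) / n) ^ (n - (m + 1)) = w
      generalize Real.exp (∑ j, φ (s j)) = e
      generalize (n.descFactorial (m + 1) : ℝ) = d
      generalize (n : ℝ) ^ (m + 1) = q
      calc a1 * (a2 * e * b1 * (d / q * b2 * w)) = (a1 * a2) * (b1 * b2) * (e * d / q * w) := by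
            ring
        _ = d * (e / q * w) := by rw [e1, e2]; ring
    · have h3 : s ∉ S ∩ {s | StrictMono s} := fun h => h2 h.1
      simp [h2, indicator]
  · simp [h1, indicator]

end

/-- The comparison of the first Poisson arrivals with the binomial approximation. -/
theorem exists_poissonArrivals_le (L δ y₀ : ℝ) (hL : 0 < L) (hδ : 0 < δ) (hy₀ : 0 < y₀) :
    ∃ D : ℝ, 0 < D ∧ ∀ (m n : ℕ) (φ : ℝ → ℝ), m + 1 ≤ n → Measurable φ → (∀ t, |φ t| ≤ L) →
      (∀ t, 0 < t → |φ t| ≤ L * (t / n) ^ δ) → ∀ S : Set (Fin (m + 1) → ℝ), MeasurableSet S →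
      poissonArrivals m S ≤ n.descFactorial (m + 1) *
        (∫⁻ s in S ∩ {s | s (Fin.last m) < n * y₀} ∩ {s | StrictMono s},
          ENNReal.ofReal ((1 - timeChange φ (s (Fin.last m)) / n) ^ (n - (m + 1)))
          ∂(Measure.pi fun _ : Fin (m + 1) => (volume.restrict (Ioi 0)).withDensity
            fun t => ENNReal.ofReal (Real.exp (φ t) / n))) +
        ENNReal.ofReal (D * (((m + 1 : ℕ) / n : ℝ) ^ δ * ((m + 1 : ℕ) : ℝ) ^ (1 / 2 : ℝ) +
          (m + 1 : ℕ) / n)) := by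
  -- Since `Θ` has slope at least `exp (-L)`, the first entry gives `c * n ≤ Θ (n * y₀)`, so
  -- truncating at `c * n` stays where `φ` is controlled. The second keeps the binomial estimate
  -- valid.
  set c : ℝ := min (Real.exp (-L) * y₀) (1 / 2) with hcdef
  have hc : 0 < c := lt_min (by positivity) (by norm_num)
  have hc' : c ≤ 1 / 2 := min_le_right _ _
  set C : ℝ := Real.exp L * L ^ 2 * (2 * (2 * (1 + 2 * δ)) ^ (1 + 2 * δ)) with hC
  have hC0 : 0 ≤ C := by positivity
  -- `1 + C` comes from the entropy bound, `4 / c ^ 2` from the binomial comparison, and `2 / c`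
  -- makes the bound trivial when `k > c * n / 2`.
  refine ⟨1 + C + 4 / c ^ 2 + 2 / c, by positivity, ?_⟩
  intro m n φ hmn hφ hM hφa S hS
  have hn : 0 < n := by omega
  have hn' : (0 : ℝ) < n := by exact_mod_cast hn
  set k : ℝ := ((m + 1 : ℕ) : ℝ) with hkdef
  have hk : 0 < k := by rw [hkdef]; positivity
  set r : ℝ := (k / n) ^ δ * k ^ (1 / 2 : ℝ) with hr
  have hr0 : 0 < r := by positivity
  have hq0 : 0 < k / n := by positivity
  rcases le_or_gt k (c * n / 2) with hkc | hkc
  · have hφa' : ∀ t, 0 < t → |φ t| ≤ (L / (n : ℝ) ^ δ) * t ^ δ := by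
      intro t ht
      refine (hφa t ht).trans_eq ?_
      rw [Real.div_rpow ht.le hn'.le]; ring
    have hY : c * n ≤ timeChange φ (n * y₀) := by
      have h1 := le_timeChange_sub hφ hM (a := 0) (b := n * y₀) (by positivity)
      rw [timeChange_zero] at h1
      have h2 : c ≤ Real.exp (-L) * y₀ := min_le_left _ _
      nlinarith
    -- The parameter `l` is taken to be `r`: the divergence is at most `C * r ^ 2`, so `l` and
    -- divergence over `l` are of the same order.
    have h1 := poissonArrivals_le_setLIntegral_exp m hφ hM hδ hφa' hr0 S
    have h2 := setLIntegral_exp_le_binomial m hφ hM hn hc hc' hkc hY S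
    rw [setLIntegral_binomial_eq m hφ hM (hS.inter (measurableSet_lt (measurable_pi_apply _)
      measurable_const))] at h2
    refine h1.trans ((add_le_add_left h2 _).trans ?_)
    rw [add_assoc]
    refine add_le_add le_rfl ?_
    rw [← ENNReal.ofReal_add (by positivity) (by positivity)]
    refine ENNReal.ofReal_le_ofReal ?_
    have hk1 : (m : ℝ) + 1 = k := by rw [hkdef]; push_cast; ring
    have hrate : Real.exp L * (L / (n : ℝ) ^ δ) ^ 2 * (2 * (2 * (1 + 2 * δ)) ^ (1 + 2 * δ) *
        ((m : ℝ) + 1) ^ (1 + 2 * δ)) / r = C * r := by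
      rw [hk1, div_eq_iff hr0.ne']
      have e1 : r * r = k ^ (1 + 2 * δ) / ((n : ℝ) ^ δ) ^ 2 := by
        have e2 : k ^ (1 / 2 : ℝ) * k ^ (1 / 2 : ℝ) = k := by
          rw [← Real.rpow_add hk]; norm_num
        rw [hr, Real.div_rpow hk.le hn'.le, Real.rpow_add hk, Real.rpow_one, mul_comm 2 δ,
          Real.rpow_mul hk.le]
        calc k ^ δ / (n : ℝ) ^ δ * k ^ (1 / 2 : ℝ) * (k ^ δ / (n : ℝ) ^ δ * k ^ (1 / 2 : ℝ))
            = (k ^ (1 / 2 : ℝ) * k ^ (1 / 2 : ℝ)) * (k ^ δ) ^ 2 / ((n : ℝ) ^ δ) ^ 2 := by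
              ring
          _ = _ := by rw [e2]; norm_cast
      rw [mul_assoc C, e1, hC]
      ring
    rw [hrate]
    have t1 : 0 ≤ 4 / c ^ 2 * r := by positivity
    have t2 : 0 ≤ 2 / c * r := by positivity
    have t3 : 0 ≤ (1 + C + 2 / c) * (k / n) := by positivity
    nlinarith
  · refine le_add_left ((prob_le_one).trans ?_)
    rw [← ENNReal.ofReal_one]
    refine ENNReal.ofReal_le_ofReal ?_
    have h1 : 1 ≤ 2 / c * (k / n) := by
      rw [div_mul_div_comm, le_div_iff₀ (by positivity)]
      linarith
    have t1 : 0 ≤ (1 + C + 4 / c ^ 2 + 2 / c) * r := by positivity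
    have t3 : 0 ≤ (1 + C + 4 / c ^ 2) * (k / n) := by positivity
    nlinarith

/-! ### The joint law of the upper order statistics. -/

theorem upperOrderStat_eq_of_strictAnti {n k : ℕ} (hkn : k ≤ n) (x : Fin n → ℝ)
    (σ : Fin k ↪ Fin n) (h1 : StrictAnti fun j => x (σ j))
    (h2 : ∀ i ∉ range σ, ∀ j, x i < x (σ j)) (j : Fin k) :
    upperOrderStat hkn x j = x (σ j) := by
  have hs : Monotone (x ∘ Tuple.sort x) := Tuple.monotone_sort x
  set v := x (σ j) with hv
  set r : Fin n := Fin.rev (Fin.castLE hkn j) with hr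
  have hrv : (r : ℕ) = n - (j + 1) := by simp [hr, Fin.val_rev]
  have hjn : (j : ℕ) < n := lt_of_lt_of_le j.2 hkn
  have c1 : (Finset.univ.filter fun i => v < (x ∘ Tuple.sort x) i).card = j := by
    rw [Finset.card_equiv (t := Finset.univ.filter fun i => v < x i) (Tuple.sort x) (by simp)]
    have : (Finset.univ.filter fun i => v < x i) = (Finset.Iio j).map σ := by
      ext i
      simp only [Finset.mem_filter, Finset.mem_univ, true_and, Finset.mem_map, Finset.mem_Iio]
      constructor
      · intro hi
        by_cases hir : i ∈ range σ
        · obtain ⟨j', rfl⟩ := hir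
          exact ⟨j', h1.lt_iff_gt.1 hi, rfl⟩
        · exact absurd hi (h2 i hir j).asymm
      · rintro ⟨j', hj', rfl⟩
        exact h1 hj'
    rw [this, Finset.card_map, Fin.card_Iio]
  have c2 : (Finset.univ.filter fun i => v ≤ (x ∘ Tuple.sort x) i).card = j + 1 := by
    rw [Finset.card_equiv (t := Finset.univ.filter fun i => v ≤ x i) (Tuple.sort x) (by simp)]
    have : (Finset.univ.filter fun i => v ≤ x i) = (Finset.Iic j).map σ := by
      ext i
      simp only [Finset.mem_filter, Finset.mem_univ, true_and, Finset.mem_map, Finset.mem_Iic]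
      constructor
      · intro hi
        by_cases hir : i ∈ range σ
        · obtain ⟨j', rfl⟩ := hir
          exact ⟨j', h1.le_iff_ge.1 hi, rfl⟩
        · exact absurd hi (not_le.2 (h2 i hir j))
      · rintro ⟨j', hj', rfl⟩
        exact h1.antitone hj'
    rw [this, Finset.card_map, Fin.card_Iic]
  change (x ∘ Tuple.sort x) r = v
  -- Sorting preserves counts: `j` entries exceed `v` and `j + 1` are at least `v`. A smaller value
  -- at `r` would force those `j + 1` entries into the `j` positions above `r`; a larger one would
  -- make all `j + 1` positions from `r` on exceed `v`.
  rcases lt_trichotomy ((x ∘ Tuple.sort x) r) v with h | h | h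
  · exfalso
    have hsub : (Finset.univ.filter fun i => v ≤ (x ∘ Tuple.sort x) i) ⊆ Finset.Ioi r := by
      intro i hi
      rw [Finset.mem_filter] at hi
      rw [Finset.mem_Ioi]
      by_contra hle
      exact absurd (hi.2.trans (hs (not_lt.1 hle))) (not_le.2 h)
    have := Finset.card_le_card hsub
    rw [c2, Fin.card_Ioi] at this
    omega
  · exact h
  · exfalso
    have hsub : Finset.Ici r ⊆ (Finset.univ.filter fun i => v < (x ∘ Tuple.sort x) i) := by
      intro i hi
      rw [Finset.mem_Ici] at hi
      simp only [Finset.mem_filter, Finset.mem_univ, true_and]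
      exact h.trans_le (hs hi)
    have := Finset.card_le_card hsub
    rw [c1, Fin.card_Ici] at this
    omega

/-- The event that the values at the indices `σ 0, …, σ m` lie in `A` and exceed all others. -/
def topEvent {m n : ℕ} (A : Set (Fin (m + 1) → ℝ)) (σ : Fin (m + 1) ↪ Fin n) :
    Set (Fin n → ℝ) :=
  {x | (∀ i ∉ range σ, x i < x (σ (Fin.last m))) ∧ (fun j => x (σ j)) ∈ A}

section

variable {m n : ℕ} {A : Set (Fin (m + 1) → ℝ)}

theorem measurableSet_topEvent (hA : MeasurableSet A) (σ : Fin (m + 1) ↪ Fin n) :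
    MeasurableSet (topEvent A σ) := by
  have h1 : MeasurableSet {x : Fin n → ℝ | ∀ i ∉ range σ, x i < x (σ (Fin.last m))} := by
    have : {x : Fin n → ℝ | ∀ i ∉ range σ, x i < x (σ (Fin.last m))} =
        ⋂ i, ⋂ (_ : i ∉ range σ), {x | x i < x (σ (Fin.last m))} := by
      ext x; simp
    rw [this]
    exact MeasurableSet.iInter fun i => MeasurableSet.iInter fun _ =>
      measurableSet_lt (measurable_pi_apply i) (measurable_pi_apply _)
  exact h1.inter (hA.preimage (by fun_prop : Measurable fun (x : Fin n → ℝ) j => x (σ j)))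

theorem upperOrderStat_of_mem_topEvent (hA : A ⊆ {y | StrictAnti y}) (hkn : m + 1 ≤ n)
    {σ : Fin (m + 1) ↪ Fin n} {x : Fin n → ℝ} (hx : x ∈ topEvent A σ) (j : Fin (m + 1)) :
    upperOrderStat hkn x j = x (σ j) :=
  upperOrderStat_eq_of_strictAnti hkn x σ (hA hx.2)
    (fun i hi j => (hx.1 i hi).trans_le ((hA hx.2).antitone (Fin.le_last j))) j

/-- On either event the selected values are the upper order statistics. Strict decrease, together
with strict domination of the unselected values, then lets the values determine the indices. -/
theorem topEvent_disjoint (hA : A ⊆ {y | StrictAnti y}) (hkn : m + 1 ≤ n) :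
    Pairwise (Function.onFun Disjoint (topEvent (n := n) A)) := by
  intro σ τ hne
  rw [Function.onFun, Set.disjoint_left]
  intro x hσ hτ
  refine hne (DFunLike.ext _ _ fun j => ?_)
  have h : x (σ j) = x (τ j) := by
    rw [← upperOrderStat_of_mem_topEvent hA hkn hσ, upperOrderStat_of_mem_topEvent hA hkn hτ]
  by_cases hr : τ j ∈ range σ
  · obtain ⟨j', hj'⟩ := hr
    rw [← hj'] at h ⊢
    exact congrArg σ ((hA hσ.2).injective h)
  · exact absurd h ((hσ.1 _ hr).trans_le
      ((hA hσ.2).antitone (Fin.le_last j))).ne'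

/-- Splitting the coordinates into those in the range of `σ` and the others. -/
def splitEquiv (σ : Fin (m + 1) ↪ Fin n) :
    Fin (m + 1) ⊕ ((range σ)ᶜ : Set (Fin n)) ≃ Fin n :=
  (Equiv.sumCongr (Equiv.ofInjective σ σ.injective) (Equiv.refl _)).trans
    (Equiv.Set.sumCompl (range σ))

/-- Given the selected coordinates `y`, the other `n - (m + 1)` coordinates are independent and each
must fall below the smallest selected value `y (Fin.last m)`. -/
theorem pi_topEvent (μ : Measure ℝ) [IsProbabilityMeasure μ] (hA : MeasurableSet A)
    (σ : Fin (m + 1) ↪ Fin n) :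
    Measure.pi (fun _ => μ) (topEvent A σ) =
      ∫⁻ y in A, μ (Iio (y (Fin.last m))) ^ (n - (m + 1)) ∂(Measure.pi fun _ => μ) := by
  classical
  have hG := (measurePreserving_piCongrLeft (fun _ : Fin n => μ) (splitEquiv σ)).comp
    (measurePreserving_sumPiEquivProdPi_symm
      (fun _ : Fin (m + 1) ⊕ ((range σ)ᶜ : Set (Fin n)) => μ))
  have hE := measurableSet_topEvent hA σ
  rw [← hG.measure_preimage hE.nullMeasurableSet, Measure.prod_apply (hG.measurable hE),
    ← lintegral_indicator hA]
  refine lintegral_congr fun y => ?_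
  have hpre : Prod.mk y ⁻¹' ((MeasurableEquiv.piCongrLeft (fun _ : Fin n => ℝ) (splitEquiv σ) ∘
      (MeasurableEquiv.sumPiEquivProdPi
        (fun _ : Fin (m + 1) ⊕ ((range σ)ᶜ : Set (Fin n)) => ℝ)).symm) ⁻¹' topEvent A σ) =
      {z | y ∈ A} ∩ univ.pi fun _ => Iio (y (Fin.last m)) := by
    ext z
    set x := MeasurableEquiv.piCongrLeft (fun _ : Fin n => ℝ) (splitEquiv σ)
      ((MeasurableEquiv.sumPiEquivProdPi
        (fun _ : Fin (m + 1) ⊕ ((range σ)ᶜ : Set (Fin n)) => ℝ)).symm (y, z)) with hx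
    have hl : ∀ j, x (σ j) = y j := fun j =>
      Equiv.piCongrLeft_apply_apply (fun _ : Fin n => ℝ) (splitEquiv σ) _ (Sum.inl j)
    have hr : ∀ i : ((range σ)ᶜ : Set (Fin n)), x i = z i := fun i =>
      Equiv.piCongrLeft_apply_apply (fun _ : Fin n => ℝ) (splitEquiv σ) _ (Sum.inr i)
    change x ∈ topEvent A σ ↔ _
    simp only [topEvent, mem_ofPred_eq, hl, mem_inter_iff, Set.mem_pi, mem_univ, true_imp_iff, mem_Iio]
    rw [and_comm]
    refine and_congr Iff.rfl ⟨fun h i => hr i ▸ h i i.2, fun h i hi => ?_⟩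
    have := h ⟨i, hi⟩
    rwa [← hr] at this
  rw [hpre]
  by_cases hy : y ∈ A
  · simp only [hy, indicator_of_mem]
    have : ({z : ((range σ)ᶜ : Set (Fin n)) → ℝ | True} : Set _) = univ := by ext; simp
    rw [this, univ_inter, Measure.pi_pi, Finset.prod_const, Finset.card_univ]
    congr 1
    rw [Fintype.card_compl_set, Fintype.card_fin, Set.card_range_of_injective σ.injective,
      Fintype.card_fin]
  · simp [hy]

theorem pi_iUnion_topEvent (μ : Measure ℝ) [IsProbabilityMeasure μ] (hA : MeasurableSet A)
    (hA' : A ⊆ {y | StrictAnti y}) (hkn : m + 1 ≤ n) :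
    Measure.pi (fun _ : Fin n => μ) (⋃ σ, topEvent A σ) = n.descFactorial (m + 1) *
      ∫⁻ y in A, μ (Iio (y (Fin.last m))) ^ (n - (m + 1)) ∂(Measure.pi fun _ => μ) := by
  rw [measure_iUnion (topEvent_disjoint hA' hkn) (measurableSet_topEvent hA)]
  simp only [pi_topEvent μ hA, tsum_fintype, Finset.sum_const, Finset.card_univ,
    Fintype.card_embedding_eq, Fintype.card_fin, nsmul_eq_mul]

end

/-! ### The six p-max stable laws: monotonicity, inverse, differentiability. -/

theorem cdfH_nonneg (i : LawType) (α x : ℝ) : 0 ≤ cdfH i α x := by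
  cases i <;> simp only [cdfH] <;> split_ifs <;> positivity

theorem cdfH_le_one (i : LawType) (α x : ℝ) : cdfH i α x ≤ 1 := by
  cases i with
  | one =>
    simp only [cdfH]
    split_ifs with h
    · exact zero_le_one
    · rw [Real.exp_le_one_iff, neg_nonpos]
      exact Real.rpow_nonneg (Real.log_nonneg (not_le.1 h).le) _
  | two =>
    simp only [cdfH]
    split_ifs with h h'
    · exact zero_le_one
    · rw [Real.exp_le_one_iff, neg_nonpos]
      exact Real.rpow_nonneg (neg_nonneg.2 (Real.log_nonpos (not_le.1 h).le h'.le)) _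
    · exact le_rfl
  | three =>
    simp only [cdfH]
    split_ifs with h
    · exact zero_le_one
    · rw [Real.exp_le_one_iff, neg_nonpos]
      exact one_div_nonneg.2 (not_le.1 h).le
  | four =>
    simp only [cdfH]
    split_ifs with h h'
    · exact zero_le_one
    · rw [Real.exp_le_one_iff, neg_nonpos]
      exact Real.rpow_nonneg (neg_nonneg.2 (Real.log_nonpos (by linarith) (by linarith))) _
    · exact le_rfl
  | five =>
    simp only [cdfH]
    split_ifs with h
    · rw [Real.exp_le_one_iff, neg_nonpos]
      exact Real.rpow_nonneg (Real.log_nonneg (by linarith)) _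
    · exact le_rfl
  | six =>
    simp only [cdfH]
    split_ifs with h
    · rwa [Real.exp_le_one_iff]
    · exact le_rfl

theorem cdfH_monotone (i : LawType) {α : ℝ} (hα : 0 < α) : Monotone (cdfH i α) := by
  intro x y hxy
  cases i with
  | one =>
    by_cases hx : x ≤ 1
    · simpa only [cdfH, if_pos hx] using cdfH_nonneg .one α y
    · have hx' := not_le.1 hx
      simp only [cdfH, if_neg hx, if_neg (not_le.2 (hx'.trans_le hxy))]
      refine Real.exp_le_exp.2 (neg_le_neg ?_)
      exact Real.rpow_le_rpow_of_nonpos (Real.log_pos hx')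
        (Real.log_le_log (by linarith) hxy) (by linarith)
  | two =>
    by_cases hx : x ≤ 0
    · simpa only [cdfH, if_pos hx] using cdfH_nonneg .two α y
    by_cases hy : y < 1
    · have hx' := not_le.1 hx
      simp only [cdfH, if_neg hx, if_neg (not_le.2 (hx'.trans_le hxy)), if_pos hy,
        if_pos (hxy.trans_lt hy)]
      refine Real.exp_le_exp.2 (neg_le_neg ?_)
      exact Real.rpow_le_rpow (neg_nonneg.2 (Real.log_nonpos (by linarith) hy.le))
        (neg_le_neg (Real.log_le_log hx' hxy)) hα.le
    · have hy1 : cdfH .two α y = 1 := by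
        simp only [cdfH, if_neg hy, if_neg (by linarith : ¬ y ≤ 0)]
      exact hy1 ▸ cdfH_le_one .two α x
  | three =>
    by_cases hx : x ≤ 0
    · simpa only [cdfH, if_pos hx] using cdfH_nonneg .three α y
    · have hx' := not_le.1 hx
      simp only [cdfH, if_neg hx, if_neg (not_le.2 (hx'.trans_le hxy))]
      exact Real.exp_le_exp.2 (neg_le_neg (one_div_le_one_div_of_le hx' hxy))
  | four =>
    by_cases hx : x ≤ -1
    · simpa only [cdfH, if_pos hx] using cdfH_nonneg .four α y
    by_cases hy : y < 0
    · have hx' := not_le.1 hx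
      simp only [cdfH, if_neg hx, if_neg (not_le.2 (hx'.trans_le hxy)), if_pos hy,
        if_pos (hxy.trans_lt hy)]
      refine Real.exp_le_exp.2 (neg_le_neg ?_)
      exact Real.rpow_le_rpow_of_nonpos
        (neg_pos.2 (Real.log_neg (by linarith) (by linarith)))
        (neg_le_neg (Real.log_le_log (by linarith) (by linarith))) (by linarith)
    · have hy1 : cdfH .four α y = 1 := by
        simp only [cdfH, if_neg hy, if_neg (by linarith : ¬ y ≤ -1)]
      exact hy1 ▸ cdfH_le_one .four α x
  | five =>
    by_cases hy : y < -1
    · simp only [cdfH, if_pos hy, if_pos (hxy.trans_lt hy)]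
      refine Real.exp_le_exp.2 (neg_le_neg ?_)
      exact Real.rpow_le_rpow (Real.log_nonneg (by linarith))
        (Real.log_le_log (by linarith) (by linarith)) hα.le
    · have hy1 : cdfH .five α y = 1 := by simp only [cdfH, if_neg hy]
      exact hy1 ▸ cdfH_le_one .five α x
  | six =>
    by_cases hy : y ≤ 0
    · simp only [cdfH, if_pos hy, if_pos (hxy.trans hy)]
      exact Real.exp_le_exp.2 hxy
    · have hy1 : cdfH .six α y = 1 := by simp only [cdfH, if_neg hy]
      exact hy1 ▸ cdfH_le_one .six α x

theorem quantileT_cdfH_and_differentiableAt (i : LawType) {α x : ℝ} (hα : 0 < α)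
    (h0 : 0 < cdfH i α x) (h1 : cdfH i α x < 1) :
    quantileT i α (cdfH i α x) = x ∧ DifferentiableAt ℝ (cdfH i α) x := by
  have e1 : -α * (-1 / α) = 1 := by field_simp
  have e2 : α * (1 / α) = 1 := by field_simp
  cases i with
  | one =>
    have hx : 1 < x := by
      by_contra h
      simp [cdfH, not_lt.1 h] at h0
    have hl := Real.log_pos hx
    refine ⟨?_, ?_⟩
    · simp only [cdfH, quantileT, if_neg (not_le.2 hx), Real.log_exp, neg_neg]
      rw [← Real.rpow_mul hl.le, e1, Real.rpow_one, Real.exp_log (by linarith)]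
    · have hev : cdfH .one α =ᶠ[𝓝 x] fun x => Real.exp (-(Real.log x) ^ (-α)) := by
        filter_upwards [lt_mem_nhds hx] with y hy
        simp only [cdfH, if_neg (not_le.2 hy)]
      refine DifferentiableAt.congr_of_eventuallyEq ?_ hev
      exact (((Real.differentiableAt_log (by linarith)).rpow_const (Or.inl hl.ne')).neg).exp
  | two =>
    have hx0 : 0 < x := by
      by_contra h
      simp [cdfH, not_lt.1 h] at h0
    have hx1 : x < 1 := by
      by_contra h
      simp [cdfH, h, not_le.2 hx0] at h1
    have hl := neg_pos.2 (Real.log_neg hx0 hx1)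
    refine ⟨?_, ?_⟩
    · simp only [cdfH, quantileT, if_neg (not_le.2 hx0), if_pos hx1, Real.log_exp, neg_neg]
      rw [← Real.rpow_mul hl.le, e2, Real.rpow_one, neg_neg, Real.exp_log hx0]
    · have hev : cdfH .two α =ᶠ[𝓝 x] fun x => Real.exp (-(-Real.log x) ^ α) := by
        filter_upwards [lt_mem_nhds hx0, gt_mem_nhds hx1] with y hy hy'
        simp only [cdfH, if_neg (not_le.2 hy), if_pos hy']
      refine DifferentiableAt.congr_of_eventuallyEq ?_ hev
      exact (((Real.differentiableAt_log hx0.ne').neg.rpow_const (Or.inl hl.ne')).neg).exp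
  | three =>
    have hx : 0 < x := by
      by_contra h
      simp [cdfH, not_lt.1 h] at h0
    refine ⟨?_, ?_⟩
    · simp only [cdfH, quantileT, if_neg (not_le.2 hx), Real.log_exp]
      field_simp
    · have hev : cdfH .three α =ᶠ[𝓝 x] fun x => Real.exp (-(1 / x)) := by
        filter_upwards [lt_mem_nhds hx] with y hy
        simp only [cdfH, if_neg (not_le.2 hy)]
      refine DifferentiableAt.congr_of_eventuallyEq ?_ hev
      exact (((differentiableAt_const 1).div differentiableAt_id hx.ne').neg).exp
  | four =>
    have hx0 : -1 < x := by
      by_contra h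
      simp [cdfH, not_lt.1 h] at h0
    have hx1 : x < 0 := by
      by_contra h
      simp [cdfH, h, not_le.2 hx0] at h1
    have hl := neg_pos.2 (Real.log_neg (by linarith : 0 < -x) (by linarith))
    refine ⟨?_, ?_⟩
    · simp only [cdfH, quantileT, if_neg (not_le.2 hx0), if_pos hx1, Real.log_exp, neg_neg]
      rw [← Real.rpow_mul hl.le, e1, Real.rpow_one, neg_neg, Real.exp_log (by linarith), neg_neg]
    · have hev : cdfH .four α =ᶠ[𝓝 x] fun x => Real.exp (-(-Real.log (-x)) ^ (-α)) := by
        filter_upwards [lt_mem_nhds hx0, gt_mem_nhds hx1] with y hy hy'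
        simp only [cdfH, if_neg (not_le.2 hy), if_pos hy']
      refine DifferentiableAt.congr_of_eventuallyEq ?_ hev
      exact (((differentiableAt_id.neg.log (by simpa using hx1.ne)).neg.rpow_const
        (Or.inl hl.ne')).neg).exp
  | five =>
    have hx : x < -1 := by
      by_contra h
      simp [cdfH, h] at h1
    have hl := Real.log_pos (by linarith : 1 < -x)
    refine ⟨?_, ?_⟩
    · simp only [cdfH, quantileT, if_pos hx, Real.log_exp, neg_neg]
      rw [← Real.rpow_mul hl.le, e2, Real.rpow_one, Real.exp_log (by linarith), neg_neg]
    · have hev : cdfH .five α =ᶠ[𝓝 x] fun x => Real.exp (-(Real.log (-x)) ^ α) := by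
        filter_upwards [gt_mem_nhds hx] with y hy
        simp only [cdfH, if_pos hy]
      refine DifferentiableAt.congr_of_eventuallyEq ?_ hev
      exact (((differentiableAt_id.neg.log (by linarith : (0 : ℝ) < -x).ne').rpow_const
        (Or.inl hl.ne')).neg).exp
  | six =>
    have hx : x < 0 := by
      by_contra h
      rcases (not_lt.1 h).eq_or_lt with h | h
      · simp [cdfH, ← h] at h1
      · simp [cdfH, not_le.2 h] at h1
    refine ⟨?_, ?_⟩
    · simp only [cdfH, quantileT, if_pos hx.le, Real.log_exp]
    · have hev : cdfH .six α =ᶠ[𝓝 x] Real.exp := by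
        filter_upwards [gt_mem_nhds hx] with y hy
        simp only [cdfH, if_pos hy.le]
      exact Real.differentiableAt_exp.congr_of_eventuallyEq hev

/-! ### The arrival coordinate, common to all six laws. -/

/-- The decreasing map carrying the arrival times to points distributed as the extremes of the
limit law. -/
def arrivalMap (i : LawType) (α y : ℝ) : ℝ := quantileT i α (Real.exp (-y))

theorem cdfH_arrivalMap (i : LawType) {α y : ℝ} (hα : 0 < α) (hy : 0 < y) :
    cdfH i α (arrivalMap i α y) = Real.exp (-y) :=
  cdfH_quantileT i hα (Real.exp_pos _) (by simpa using hy)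

theorem differentiableAt_arrivalMap (i : LawType) (α : ℝ) {y : ℝ} (hy : 0 < y) :
    DifferentiableAt ℝ (arrivalMap i α) y := by
  have hp : ∀ r : ℝ, DifferentiableAt ℝ (fun y : ℝ => y ^ r) y := fun r =>
    differentiableAt_id.rpow_const (Or.inl hy.ne')
  unfold arrivalMap
  cases i <;> simp only [quantileT, Real.log_exp, neg_neg]
  · exact (hp _).exp
  · exact (hp _).neg.exp
  · exact (differentiableAt_const _).div differentiableAt_id.neg (by simpa using hy.ne')
  · exact (hp _).neg.exp.neg
  · exact (hp _).exp.neg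
  · exact differentiableAt_id.neg

/-- In the arrival coordinate all rates become the same power, free of `i` and `α`; this is why one
constant serves all the laws. -/
theorem gRate_arrivalMap (i : LawType) {α y : ℝ} (hα : 0 < α) (δ : ℝ) (hy : 0 < y) :
    gRate i α δ (arrivalMap i α y) = y ^ δ := by
  have e1 : -1 / α * (-(α * δ)) = δ := by field_simp
  have e2 : 1 / α * (α * δ) = δ := by field_simp
  cases i <;> simp only [arrivalMap, gRate, quantileT, Real.log_exp, neg_neg]
  · rw [← Real.rpow_mul hy.le, e1]
  · rw [← Real.rpow_mul hy.le, e2]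
  · rw [neg_div_neg_eq, Real.div_rpow zero_le_one hy.le, Real.one_rpow, one_div_one_div]
  · rw [← Real.rpow_mul hy.le, e1]
  · rw [← Real.rpow_mul hy.le, e2]
  · rw [abs_neg, abs_of_pos hy]

/-- This is p-max stability: the norming constants are exactly those that undo a rescaling of the
arrival times by `n`. -/
theorem powNormalize_arrivalMap (i : LawType) {α y : ℝ} (hy : 0 < y) {n : ℕ}
    (hn : 0 < n) :
    powNormalize (normA i n) (normB i α n) (arrivalMap i α (y / n)) = arrivalMap i α y := by
  have hn' : (0 : ℝ) < n := by exact_mod_cast hn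
  have f1 : (y / n) ^ (-1 / α) * (1 / (n : ℝ) ^ (1 / α)) = y ^ (-1 / α) := by
    rw [Real.div_rpow hy.le hn'.le, neg_div, Real.rpow_neg hn'.le]
    field_simp
  have f2 : (y / n) ^ (1 / α) * (1 / (n : ℝ) ^ (-1 / α)) = y ^ (1 / α) := by
    rw [Real.div_rpow hy.le hn'.le, neg_div, Real.rpow_neg hn'.le]
    field_simp
  cases i <;>
    simp only [arrivalMap, powNormalize, normA, normB, quantileT, Real.log_exp, neg_neg, div_one]
  · rw [abs_of_pos (Real.exp_pos _), Real.sign_of_pos (Real.exp_pos _), ← Real.exp_mul, f1,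
      mul_one]
  · rw [abs_of_pos (Real.exp_pos _), Real.sign_of_pos (Real.exp_pos _), ← Real.exp_mul, neg_mul,
      f2, mul_one]
  · have h : 0 < -1 / -(y / n) := by rw [neg_div_neg_eq]; positivity
    rw [Real.sign_of_pos h, abs_of_pos (div_pos h hn'), Real.rpow_one, mul_one]
    field_simp
  · rw [abs_neg, abs_of_pos (Real.exp_pos _), Real.sign_of_neg (neg_neg_of_pos (Real.exp_pos _)),
      ← Real.exp_mul, neg_mul, f1, mul_neg_one]
  · rw [abs_neg, abs_of_pos (Real.exp_pos _), Real.sign_of_neg (neg_neg_of_pos (Real.exp_pos _)),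
      ← Real.exp_mul, f2, mul_neg_one]
  · have h : -(y / n) < 0 := by have := div_pos hy hn'; linarith
    rw [Real.sign_of_neg h, Real.rpow_one, mul_neg_one, abs_of_neg]
    · field_simp
    · exact div_neg_of_neg_of_pos h (by positivity)

section

variable {i : LawType} {α : ℝ}

theorem strictAntiOn_arrivalMap (hα : 0 < α) : StrictAntiOn (arrivalMap i α) (Ioi 0) := by
  intro a ha b hb hab
  by_contra h
  have := cdfH_monotone i hα (not_lt.1 h)
  rw [cdfH_arrivalMap i hα ha, cdfH_arrivalMap i hα hb, Real.exp_le_exp] at this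
  linarith

theorem exists_arrivalMap_eq (hα : 0 < α) {x : ℝ} (h0 : 0 < cdfH i α x)
    (h1 : cdfH i α x < 1) : ∃ y, 0 < y ∧ arrivalMap i α y = x := by
  refine ⟨-Real.log (cdfH i α x), neg_pos.2 (Real.log_neg h0 h1), ?_⟩
  rw [arrivalMap, neg_neg, Real.exp_log h0]
  exact (quantileT_cdfH_and_differentiableAt i hα h0 h1).1

theorem auxW_nonneg (hα : 0 < α) (x : ℝ) : 0 ≤ auxW (cdfH i α) x :=
  div_nonneg (cdfH_monotone i hα).deriv_nonneg (cdfH_nonneg i α x)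

/-- Differentiate `H (τ y) = exp (-y)` and divide by `H (τ y)`. Hence `w` is the density of the
image of Lebesgue measure under `τ`. -/
theorem abs_deriv_arrivalMap_mul (hα : 0 < α) {y : ℝ} (hy : 0 < y) :
    |deriv (arrivalMap i α) y| * auxW (cdfH i α) (arrivalMap i α y) = 1 := by
  have hH := cdfH_arrivalMap i hα hy
  have hd := (quantileT_cdfH_and_differentiableAt i hα (x := arrivalMap i α y)
    (by rw [hH]; exact Real.exp_pos _) (by rw [hH]; simpa using hy)).2
  have hτ := differentiableAt_arrivalMap i α hy
  have h1 := hd.hasDerivAt.comp y hτ.hasDerivAt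
  have h2 : HasDerivAt (fun y : ℝ => Real.exp (-y)) (Real.exp (-y) * -1) y :=
    (hasDerivAt_neg y).exp
  have hev : (cdfH i α ∘ arrivalMap i α) =ᶠ[𝓝 y] fun y => Real.exp (-y) := by
    filter_upwards [lt_mem_nhds hy] with z hz using cdfH_arrivalMap i hα hz
  have h3 := (h2.congr_of_eventuallyEq hev).unique h1
  have h4 : deriv (arrivalMap i α) y * auxW (cdfH i α) (arrivalMap i α y) = -1 := by
    rw [auxW, hH, mul_div_assoc', div_eq_iff (Real.exp_pos _).ne']
    linarith
  rw [← abs_of_nonneg (auxW_nonneg hα (arrivalMap i α y)), ← abs_mul, h4]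
  simp

/-- Off the image `H` is 0 or 1. Where it is 0, division by zero gives 0; where it is 1, `H` has a
maximum, so `deriv` is 0 there even if `H` has a corner. -/
theorem auxW_eq_zero (hα : 0 < α) {x : ℝ} (hx : x ∉ arrivalMap i α '' Ioi 0) :
    auxW (cdfH i α) x = 0 := by
  rcases (cdfH_nonneg i α x).eq_or_lt with h0 | h0
  · rw [auxW, ← h0, div_zero]
  rcases (cdfH_le_one i α x).lt_or_eq with h1 | h1
  · obtain ⟨y, hy, h⟩ := exists_arrivalMap_eq hα h0 h1
    exact absurd ⟨y, hy, h⟩ hx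
  · have : IsLocalMax (cdfH i α) x := Eventually.of_forall fun z => by
      rw [h1]; exact cdfH_le_one i α z
    rw [auxW, this.deriv_eq_zero, zero_div]

theorem arrivalMap_lt_rightEnd (hα : 0 < α) {y : ℝ} (hy : 0 < y) :
    (arrivalMap i α y : EReal) < rightEnd (cdfH i α) := by
  have hy2 : 0 < y / 2 := by linarith
  have h1 : (arrivalMap i α y : EReal) < arrivalMap i α (y / 2) := by
    rw [EReal.coe_lt_coe_iff]
    exact strictAntiOn_arrivalMap hα hy2 hy (by linarith)
  refine h1.trans_le (le_sSup ⟨_, ?_, rfl⟩)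
  rw [mem_ofPred_eq, cdfH_arrivalMap i hα hy2]
  simpa using hy2

theorem exists_arrivalMap_eq_of_lt (hα : 0 < α) {x y : ℝ} (hy : 0 < y)
    (hx : arrivalMap i α y < x) (hr : (x : EReal) < rightEnd (cdfH i α)) :
    ∃ z, 0 < z ∧ z < y ∧ arrivalMap i α z = x := by
  obtain ⟨_, ⟨x', hx', rfl⟩, hlt⟩ := lt_sSup_iff.1 hr
  have h1 : cdfH i α x < 1 :=
    (cdfH_monotone i hα (EReal.coe_lt_coe_iff.1 hlt).le).trans_lt hx'
  have h0 : 0 < cdfH i α x := by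
    refine lt_of_lt_of_le ?_ (cdfH_monotone i hα hx.le)
    rw [cdfH_arrivalMap i hα hy]
    exact Real.exp_pos _
  obtain ⟨z, hz, rfl⟩ := exists_arrivalMap_eq hα h0 h1
  exact ⟨z, hz, (strictAntiOn_arrivalMap hα).lt_iff_gt hy hz |>.1 hx, rfl⟩

end

/-! ### The limit law as the image of the Poisson arrivals. -/

theorem measurable_arrivalMap (i : LawType) (α : ℝ) : Measurable (arrivalMap i α) := by
  unfold arrivalMap
  cases i <;> simp only [quantileT, Real.log_exp, neg_neg] <;> fun_prop

section

variable {i : LawType} {α : ℝ}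

theorem measurable_auxW (hα : 0 < α) : Measurable (auxW (cdfH i α)) :=
  (measurable_deriv _).div (cdfH_monotone i hα).measurable

theorem image_arrivalMap_Ioi (hα : 0 < α) :
    arrivalMap i α '' Ioi 0 = {x | 0 < cdfH i α x} ∩ {x | cdfH i α x < 1} := by
  ext x
  constructor
  · rintro ⟨y, hy, rfl⟩
    have hy' : 0 < y := hy
    refine ⟨?_, ?_⟩
    · rw [mem_ofPred_eq, cdfH_arrivalMap i hα hy]; exact Real.exp_pos _
    · rw [mem_ofPred_eq, cdfH_arrivalMap i hα hy]; simpa using hy'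
  · rintro ⟨h0, h1⟩
    exact exists_arrivalMap_eq hα h0 h1

theorem measurableSet_image_arrivalMap (hα : 0 < α) :
    MeasurableSet (arrivalMap i α '' Ioi 0) := by
  have hm := (cdfH_monotone i hα).measurable
  rw [image_arrivalMap_Ioi hα]
  exact (measurableSet_lt measurable_const hm).inter (measurableSet_lt hm measurable_const)

theorem strictAntiOn_arrivalMap_div (hα : 0 < α) {n : ℕ} (hn : 0 < n) :
    StrictAntiOn (fun s => arrivalMap i α (s / n)) (Ioi 0) := by
  have hn' : (0 : ℝ) < n := by exact_mod_cast hn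
  intro a ha b hb hab
  exact strictAntiOn_arrivalMap hα (div_pos ha hn') (div_pos hb hn')
    (div_lt_div_of_pos_right hab hn')

theorem setLIntegral_image_arrivalMap (hα : 0 < α) {n : ℕ} (hn : 0 < n) {T : Set ℝ}
    (hT : MeasurableSet T) (hT0 : T ⊆ Ioi 0) (G : ℝ → ℝ≥0∞) :
    ∫⁻ x in (fun s => arrivalMap i α (s / n)) '' T, ENNReal.ofReal (auxW (cdfH i α) x) * G x =
      ∫⁻ s in T, ENNReal.ofReal (1 / n) * G (arrivalMap i α (s / n)) := by
  have hn' : (0 : ℝ) < n := by exact_mod_cast hn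
  have hd : ∀ s ∈ T, HasDerivWithinAt (fun s => arrivalMap i α (s / n))
      (deriv (arrivalMap i α) (s / n) * (1 / n)) T s := by
    intro s hs
    have h1 := (differentiableAt_arrivalMap i α (div_pos (hT0 hs) hn')).hasDerivAt
    exact (h1.comp s ((hasDerivAt_id s).div_const _)).hasDerivWithinAt
  rw [lintegral_image_eq_lintegral_abs_deriv_mul hT hd
    ((strictAntiOn_arrivalMap_div hα hn).injOn.mono hT0)]
  refine setLIntegral_congr_fun hT fun s hs => ?_
  have h2 := abs_deriv_arrivalMap_mul (i := i) hα (div_pos (hT0 hs) hn')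
  change ENNReal.ofReal _ * (_ * G _) = _
  rw [← mul_assoc, ← ENNReal.ofReal_mul (abs_nonneg _), abs_mul,
    mul_right_comm, h2, one_mul, abs_of_pos (by positivity)]

theorem map_arrivalMap (hα : 0 < α) :
    (volume.restrict (Ioi 0)).map (arrivalMap i α) =
      volume.withDensity fun x => ENNReal.ofReal (auxW (cdfH i α) x) := by
  have hD := measurableSet_image_arrivalMap (i := i) hα
  ext A hA
  have h := setLIntegral_image_arrivalMap (i := i) hα one_pos measurableSet_Ioi Subset.rfl
    (A.indicator 1)
  simp only [Nat.cast_one, div_one, ENNReal.ofReal_one, one_mul] at h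
  rw [Measure.map_apply (measurable_arrivalMap i α) hA, withDensity_apply _ hA,
    ← lintegral_indicator_one ((measurable_arrivalMap i α) hA)]
  calc ∫⁻ s in Ioi 0, (arrivalMap i α ⁻¹' A).indicator 1 s
      = ∫⁻ s in Ioi 0, A.indicator 1 (arrivalMap i α s) := rfl
    _ = _ := h.symm
    _ = ∫⁻ x, ENNReal.ofReal (auxW (cdfH i α) x) * A.indicator 1 x := by
        rw [← lintegral_indicator hD]
        refine lintegral_congr fun x => ?_
        by_cases hx : x ∈ arrivalMap i α '' Ioi 0
        · rw [indicator_of_mem hx]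
        · rw [indicator_of_notMem hx, auxW_eq_zero hα hx]; simp
    _ = _ := by
        rw [← lintegral_indicator hA]
        refine lintegral_congr fun x => ?_
        by_cases hx : x ∈ A <;> simp [hx]

theorem strictAnti_arrivalMap_iff (hα : 0 < α) {n : ℕ} (hn : 0 < n) {k : ℕ} {s : Fin k → ℝ}
    (hs : ∀ j, 0 < s j) :
    StrictAnti (fun j => arrivalMap i α (s j / n)) ↔ StrictMono s := by
  have h := strictAntiOn_arrivalMap_div (i := i) hα hn
  exact ⟨fun h' a b hab => (h.lt_iff_gt (hs b) (hs a)).1 (h' hab),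
    fun h' a b hab => h (hs a) (hs b) (h' hab)⟩

/-- The limit law is the image of the law of the Poisson arrivals. -/
theorem limitLaw_apply (hα : 0 < α) (m : ℕ) {B : Set (Fin (m + 1) → ℝ)}
    (hB : MeasurableSet B) (hk : 1 ≤ m + 1) :
    limitLaw (cdfH i α) (m + 1) hk B =
      poissonArrivals m {s | (fun j => arrivalMap i α (s j)) ∈ B} := by
  have hτ := measurable_arrivalMap i α
  have hH := (cdfH_monotone i hα).measurable
  have hw := measurable_auxW (i := i) hα
  have hτ' : Measurable fun (s : Fin (m + 1) → ℝ) j => arrivalMap i α (s j) := by fun_prop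
  have hSA := measurableSet_strictAnti (m + 1)
  have hsf : SigmaFinite (volume.withDensity fun x => ENNReal.ofReal (auxW (cdfH i α) x)) :=
    SigmaFinite.withDensity_ofReal _
  have hsf' : SigmaFinite ((volume.restrict (Ioi 0)).map (arrivalMap i α)) := by
    rw [map_arrivalMap hα]; exact hsf
  have hS : MeasurableSet {s : Fin (m + 1) → ℝ | (fun j => arrivalMap i α (s j)) ∈ B} :=
    hτ' hB
  have hF : Measurable ((B ∩ {x | StrictAnti x}).indicator
      fun x : Fin (m + 1) → ℝ => ENNReal.ofReal (cdfH i α (x (Fin.last m)))) :=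
    Measurable.indicator (by fun_prop) (hB.inter hSA)
  have hpi : Measure.pi (fun _ : Fin (m + 1) =>
      (volume.restrict (Ioi 0)).map (arrivalMap i α)) =
      (Measure.pi fun _ : Fin (m + 1) => volume).withDensity
        (fun x => ∏ j, ENNReal.ofReal (auxW (cdfH i α) (x j))) := by
    rw [← pi_withDensity (fun _ : Fin (m + 1) => (volume : Measure ℝ))
      (f := fun _ x => ENNReal.ofReal (auxW (cdfH i α) x)) (fun _ => by fun_prop)]
    simp only [map_arrivalMap hα]
  calc limitLaw (cdfH i α) (m + 1) hk B
      = ∫⁻ x, (B ∩ {x | StrictAnti x}).indicator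
          (fun x : Fin (m + 1) → ℝ => ENNReal.ofReal (cdfH i α (x (Fin.last m)))) x
          ∂(Measure.pi fun _ : Fin (m + 1) =>
            (volume.restrict (Ioi 0)).map (arrivalMap i α)) := by
        rw [hpi, lintegral_withDensity_eq_lintegral_mul _ (by fun_prop) hF, limitLaw,
          withDensity_apply _ hB, ← lintegral_indicator hB, volume_pi]
        refine lintegral_congr fun x => ?_
        by_cases hx : x ∈ B
        · by_cases hx' : StrictAnti x
          · have h3 : x ∈ B ∩ {x | StrictAnti x} := ⟨hx, hx'⟩
            rw [indicator_of_mem hx, indicator_of_mem (by exact hx'), Pi.mul_apply,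
              indicator_of_mem h3, ENNReal.ofReal_mul (cdfH_nonneg _ _ _),
              ENNReal.ofReal_prod_of_nonneg (fun _ _ => auxW_nonneg hα _), mul_comm]
            rfl
          · simp [hx', indicator]
        · simp [hx, indicator]
    _ = ∫⁻ s, (B ∩ {x | StrictAnti x}).indicator
          (fun x : Fin (m + 1) → ℝ => ENNReal.ofReal (cdfH i α (x (Fin.last m))))
          (fun j => arrivalMap i α (s j))
          ∂(Measure.pi fun _ : Fin (m + 1) => volume.restrict (Ioi 0)) := by
        rw [← Measure.pi_map_pi (fun _ => hτ.aemeasurable), lintegral_map hF hτ']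
    _ = _ := by
        rw [← lintegral_indicator_one hS, lintegral_poissonArrivals m
          (Measurable.indicator measurable_one hS)]
        refine lintegral_congr_ae ?_
        -- On positive points `H (τ (s_m)) = exp (-s_m)`, and the decreasing `τ` exchanges
        -- decreasing and increasing sequences, so the integrand is the arrival density.
        filter_upwards [ae_pos_pi (m + 1)] with s hs
        have hiff : StrictAnti (fun j => arrivalMap i α (s j)) ↔ StrictMono s := by
          simpa using strictAnti_arrivalMap_iff (i := i) hα one_pos hs
        by_cases h1 : StrictMono s
        · by_cases h2 : (fun j => arrivalMap i α (s j)) ∈ B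
          · simp [indicator, h1, h2, hiff, cdfH_arrivalMap i hα (hs _)]
          · simp [indicator, h2]
        · simp [indicator, h1, hiff]

end

/-! ### The sample density in the arrival coordinate. -/

section

variable {i : LawType} {α : ℝ} {n : ℕ} {f φ : ℝ → ℝ} {Y L : ℝ}

/-- The factor `w` of `f` is absorbed by the Jacobian of `τ (s / n)`, which leaves `exp (φ s) / n`.
Dividing by `w` is legitimate because `w` does not vanish on the image. -/
theorem setLIntegral_image_density (hα : 0 < α) (hn : 0 < n)
    (hfφ : ∀ s, 0 < s → s < Y → f (arrivalMap i α (s / n)) =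
      auxW (cdfH i α) (arrivalMap i α (s / n)) * Real.exp (φ s))
    {T : Set ℝ} (hT : MeasurableSet T) (hTY : T ⊆ Ioo 0 Y) (G : ℝ → ℝ≥0∞) :
    ∫⁻ x in (fun s => arrivalMap i α (s / n)) '' T, ENNReal.ofReal (f x) * G x =
      ∫⁻ s in T, ENNReal.ofReal (Real.exp (φ s) / n) * G (arrivalMap i α (s / n)) := by
  have hT0 : T ⊆ Ioi 0 := fun s hs => (hTY hs).1
  have hanti := (strictAntiOn_arrivalMap_div (i := i) hα hn).antitoneOn.mono hT0
  have hn' : (0 : ℝ) < n := by exact_mod_cast hn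
  have hw : ∀ s ∈ T, auxW (cdfH i α) (arrivalMap i α (s / n)) ≠ 0 := fun s hs =>
    right_ne_zero_of_mul_eq_one (abs_deriv_arrivalMap_mul hα (div_pos (hT0 hs) hn'))
  have h := setLIntegral_image_arrivalMap (i := i) hα hn hT hT0
    (fun x => ENNReal.ofReal (f x / auxW (cdfH i α) x) * G x)
  rw [setLIntegral_congr_fun (g := fun x => ENNReal.ofReal (auxW (cdfH i α) x) *
    (ENNReal.ofReal (f x / auxW (cdfH i α) x) * G x)) (hT.image_of_antitoneOn hanti), h]
  · refine setLIntegral_congr_fun hT fun s hs => ?_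
    rw [← mul_assoc, ← ENNReal.ofReal_mul (by positivity), hfφ s (hTY hs).1 (hTY hs).2,
      mul_div_cancel_left₀ _ (hw s hs), one_div_mul_eq_div]
  · rintro _ ⟨s, hs, rfl⟩
    simp only
    rw [← mul_assoc, ← ENNReal.ofReal_mul (auxW_nonneg hα _), mul_div_cancel₀ _ (hw s hs)]

theorem setLIntegral_inter_eq_mul_indicator {C : Set ℝ} (hC : MeasurableSet C) (T : Set ℝ)
    (u : ℝ → ℝ≥0∞) : ∫⁻ x in C ∩ T, u x = ∫⁻ x in T, u x * C.indicator 1 x := by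
  rw [← Measure.restrict_restrict hC, ← lintegral_indicator hC]
  refine lintegral_congr fun x => ?_
  by_cases hx : x ∈ C <;> simp [hx]

theorem withDensity_restrict_image (hα : 0 < α) (hn : 0 < n)
    (hfφ : ∀ s, 0 < s → s < Y → f (arrivalMap i α (s / n)) =
      auxW (cdfH i α) (arrivalMap i α (s / n)) * Real.exp (φ s)) :
    (volume.withDensity fun x => ENNReal.ofReal (f x)).restrict
        ((fun s => arrivalMap i α (s / n)) '' Ioo 0 Y) =
      (((volume.restrict (Ioi 0)).withDensity fun s =>
        ENNReal.ofReal (Real.exp (φ s) / n)).restrict (Ioo 0 Y)).map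
          (fun s => arrivalMap i α (s / n)) := by
  have hanti := (strictAntiOn_arrivalMap_div (i := i) hα hn).antitoneOn.mono
    (fun s (hs : s ∈ Ioo 0 Y) => hs.1)
  have hJ := measurableSet_Ioo.image_of_antitoneOn hanti
  have hτ : Measurable fun s : ℝ => arrivalMap i α (s / n) :=
    (measurable_arrivalMap i α).comp (by fun_prop)
  ext A hA
  have h := setLIntegral_image_density hα hn hfφ measurableSet_Ioo Subset.rfl (A.indicator 1)
  rw [Measure.map_apply hτ hA, Measure.restrict_apply hA, Measure.restrict_apply (hτ hA),
    withDensity_apply _ (hA.inter hJ), withDensity_apply _ ((hτ hA).inter measurableSet_Ioo),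
    Measure.restrict_restrict ((hτ hA).inter measurableSet_Ioo),
    show (fun s : ℝ => arrivalMap i α (s / n)) ⁻¹' A ∩ Ioo 0 Y ∩ Ioi 0 =
      (fun s : ℝ => arrivalMap i α (s / n)) ⁻¹' A ∩ Ioo 0 Y from
      inter_eq_left.2 fun s hs => hs.2.1,
    setLIntegral_inter_eq_mul_indicator hA, setLIntegral_inter_eq_mul_indicator (hτ hA)]
  exact h

/-- The mass at or above `τ (s / n)` lies in the image of `(0, s]`, which carries `Θ s / n`, up to a
null set. Beyond the right end `f` vanishes; at the right end itself `f` is not prescribed, but that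
is at most one point. -/
theorem one_sub_le_measure_Iio (hα : 0 < α) (hn : 0 < n) (hφ : Measurable φ)
    (hL : ∀ t, |φ t| ≤ L)
    (hfφ : ∀ s, 0 < s → s < Y → f (arrivalMap i α (s / n)) =
      auxW (cdfH i α) (arrivalMap i α (s / n)) * Real.exp (φ s))
    (hf0 : ∀ x : ℝ, rightEnd (cdfH i α) < (x : EReal) → f x = 0)
    (hμ : IsProbabilityMeasure (volume.withDensity fun x => ENNReal.ofReal (f x)))
    {s : ℝ} (hs : 0 < s) (hsY : s < Y) :
    timeChange φ s / n ≤ 1 ∧ ENNReal.ofReal (1 - timeChange φ s / n) ≤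
      (volume.withDensity fun x => ENNReal.ofReal (f x)) (Iio (arrivalMap i α (s / n))) := by
  set μ := volume.withDensity fun x => ENNReal.ofReal (f x) with hμdef
  have hn' : (0 : ℝ) < n := by exact_mod_cast hn
  have hsub : Ioc 0 s ⊆ Ioo 0 Y := fun t ht => ⟨ht.1, ht.2.trans_lt hsY⟩
  have hanti := (strictAntiOn_arrivalMap_div (i := i) hα hn)
  have himg := measurableSet_Ioc.image_of_antitoneOn
    (hanti.antitoneOn.mono (fun t (ht : t ∈ Ioc 0 s) => ht.1))
  have h1 : μ ((fun s => arrivalMap i α (s / n)) '' Ioc 0 s) =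
      ENNReal.ofReal (timeChange φ s / n) := by
    have h := setLIntegral_image_density hα hn hfφ measurableSet_Ioc hsub 1
    simp only [Pi.one_apply, mul_one] at h
    have hint : IntervalIntegrable (fun t => Real.exp (φ t) / n) volume 0 s :=
      (intervalIntegrable_exp hφ hL 0 s).div_const _
    rw [hμdef, withDensity_apply _ himg, h, ← ofReal_integral_eq_lintegral_ofReal
      ((intervalIntegrable_iff_integrableOn_Ioc_of_le hs.le).1 hint)
      (Eventually.of_forall fun t => by positivity), ← intervalIntegral.integral_of_le hs.le,
      intervalIntegral.integral_div]
    rfl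
  have h2 : timeChange φ s / n ≤ 1 := by
    have := h1 ▸ prob_le_one (μ := μ) (s := (fun s => arrivalMap i α (s / n)) '' Ioc 0 s)
    simpa using this
  refine ⟨h2, ?_⟩
  have h3 : μ {x : ℝ | rightEnd (cdfH i α) < (x : EReal)} = 0 := by
    have hm : MeasurableSet {x : ℝ | rightEnd (cdfH i α) < (x : EReal)} :=
      measurableSet_lt measurable_const measurable_coe_real_ereal
    rw [hμdef, withDensity_apply _ hm, setLIntegral_congr_fun (g := fun _ => 0) hm
      (fun x hx => by simp [hf0 x hx])]
    simp
  have h4 : μ {x : ℝ | (x : EReal) = rightEnd (cdfH i α)} = 0 := by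
    refine (withDensity_absolutelyContinuous volume _) (Set.Subsingleton.measure_zero ?_ _)
    intro x hx y hy
    exact EReal.coe_injective (hx.trans hy.symm)
  have hcover : Ici (arrivalMap i α (s / n)) ⊆
      ((fun s => arrivalMap i α (s / n)) '' Ioc 0 s) ∪
        ({x : ℝ | rightEnd (cdfH i α) < (x : EReal)} ∪
          {x : ℝ | (x : EReal) = rightEnd (cdfH i α)}) := by
    intro x hx
    rcases lt_trichotomy (x : EReal) (rightEnd (cdfH i α)) with h | h | h
    · left
      rcases (mem_Ici.1 hx).eq_or_lt with rfl | hx'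
      · exact ⟨s, ⟨hs, le_rfl⟩, rfl⟩
      · obtain ⟨z, hz, hzs, rfl⟩ := exists_arrivalMap_eq_of_lt hα (div_pos hs hn') hx' h
        refine ⟨n * z, ⟨by positivity, ?_⟩, ?_⟩
        · rw [lt_div_iff₀ hn'] at hzs
          linarith
        · simp only
          rw [mul_div_cancel_left₀ _ hn'.ne']
    · exact Or.inr (Or.inr h)
    · exact Or.inr (Or.inl h)
  have h5 : μ (Ici (arrivalMap i α (s / n))) ≤ ENNReal.ofReal (timeChange φ s / n) := by
    refine (measure_mono hcover).trans ((measure_union_le _ _).trans ?_)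
    rw [h1, measure_union_null h3 h4, add_zero]
  have h6 : μ (Iio (arrivalMap i α (s / n))) = 1 - μ (Ici (arrivalMap i α (s / n))) := by
    rw [← compl_Ici, prob_compl_eq_one_sub measurableSet_Ici]
  rw [h6, ENNReal.ofReal_sub _ (by
    have := (strictMono_timeChange hφ hL).monotone hs.le
    rw [timeChange_zero] at this
    positivity), ENNReal.ofReal_one]
  exact tsub_le_tsub_left h5 1

/-- The joint law of the upper extremes dominates the binomial approximation. -/
theorem descFactorial_mul_le_pi_topEvent {m : ℕ} (hmn : m + 1 ≤ n) (hα : 0 < α)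
    (hφ : Measurable φ) (hL : ∀ t, |φ t| ≤ L)
    (hfφ : ∀ s, 0 < s → s < Y → f (arrivalMap i α (s / n)) =
      auxW (cdfH i α) (arrivalMap i α (s / n)) * Real.exp (φ s))
    (hf0 : ∀ x : ℝ, rightEnd (cdfH i α) < (x : EReal) → f x = 0)
    (hμ : IsProbabilityMeasure (volume.withDensity fun x => ENNReal.ofReal (f x)))
    {A : Set (Fin (m + 1) → ℝ)} (hA : MeasurableSet A) (hA' : A ⊆ {y | StrictAnti y})
    {S : Set (Fin (m + 1) → ℝ)} (hS : MeasurableSet S)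
    (hSA : ∀ s ∈ S, (∀ j, 0 < s j) → StrictMono s →
      (fun j => arrivalMap i α (s j / n)) ∈ A) :
    n.descFactorial (m + 1) *
        (∫⁻ s in S ∩ {s | s (Fin.last m) < Y} ∩ {s | StrictMono s},
          ENNReal.ofReal ((1 - timeChange φ (s (Fin.last m)) / n) ^ (n - (m + 1)))
          ∂(Measure.pi fun _ : Fin (m + 1) => (volume.restrict (Ioi 0)).withDensity
            fun t => ENNReal.ofReal (Real.exp (φ t) / n))) ≤
      Measure.pi (fun _ : Fin n => volume.withDensity fun x => ENNReal.ofReal (f x))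
        (⋃ σ, topEvent A σ) := by
  set μ := volume.withDensity fun x => ENNReal.ofReal (f x) with hμdef
  set γ := (volume.restrict (Ioi (0 : ℝ))).withDensity
    fun t => ENNReal.ofReal (Real.exp (φ t) / n) with hγdef
  have hn : 0 < n := by omega
  have hτ : Measurable fun s : ℝ => arrivalMap i α (s / n) :=
    (measurable_arrivalMap i α).comp (by fun_prop)
  have hτ' : Measurable fun (s : Fin (m + 1) → ℝ) j => arrivalMap i α (s j / n) :=
    measurable_pi_lambda _ fun j => hτ.comp (measurable_pi_apply j)
  have hγ : SigmaFinite γ := SigmaFinite.withDensity_ofReal _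
  have hrest := withDensity_restrict_image hα hn hfφ
  rw [← hμdef, ← hγdef] at hrest
  have hsf : SigmaFinite ((γ.restrict (Ioo 0 Y)).map fun s => arrivalMap i α (s / n)) := by
    rw [← hrest]; infer_instance
  have hsetm : MeasurableSet (S ∩ {s | s (Fin.last m) < Y} ∩ {s | StrictMono s}) :=
    (hS.inter (measurableSet_lt (measurable_pi_apply _) measurable_const)).inter
      (measurableSet_strictMono _)
  have hIio : Measurable fun y : Fin (m + 1) → ℝ => μ (Iio (y (Fin.last m))) ^ (n - (m + 1)) := by
    have hmono : Monotone fun x : ℝ => μ (Iio x) := fun a b hab =>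
      measure_mono (Iio_subset_Iio hab)
    exact (hmono.measurable.comp (measurable_pi_apply _)).pow_const _
  have hG : Measurable (A.indicator fun y => μ (Iio (y (Fin.last m))) ^ (n - (m + 1))) :=
    hIio.indicator hA
  rw [pi_iUnion_topEvent μ hA hA' hmn]
  gcongr _ * ?_
  have hpos : ∀ᵐ s : Fin (m + 1) → ℝ ∂(Measure.pi fun _ => γ), ∀ j, 0 < s j := by
    rw [ae_all_iff]
    intro j
    exact Measure.tendsto_eval_ae_ae.eventually
      ((withDensity_absolutelyContinuous _ _).ae_le (ae_restrict_mem measurableSet_Ioi))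
  calc _ = ∫⁻ s, (S ∩ {s | s (Fin.last m) < Y} ∩ {s | StrictMono s}).indicator
          (fun s => ENNReal.ofReal ((1 - timeChange φ (s (Fin.last m)) / n) ^ (n - (m + 1)))) s
          ∂(Measure.pi fun _ => γ) := (lintegral_indicator hsetm _).symm
    _ ≤ ∫⁻ s in univ.pi (fun _ => Ioo 0 Y),
          A.indicator (fun y => μ (Iio (y (Fin.last m))) ^ (n - (m + 1)))
            (fun j => arrivalMap i α (s j / n)) ∂(Measure.pi fun _ => γ) := by
        rw [← lintegral_indicator (MeasurableSet.univ_pi fun _ => measurableSet_Ioo)]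
        refine lintegral_mono_ae ?_
        filter_upwards [hpos] with s hs
        by_cases h : s ∈ S ∩ {s | s (Fin.last m) < Y} ∩ {s | StrictMono s}
        · have hY : s (Fin.last m) < Y := h.1.2
          have hmem : s ∈ univ.pi fun _ : Fin (m + 1) => Ioo 0 Y := fun j _ =>
            ⟨hs j, (h.2.monotone (Fin.le_last j)).trans_lt hY⟩
          have h3 := one_sub_le_measure_Iio hα hn hφ hL hfφ hf0 hμ (hs (Fin.last m)) hY
          rw [indicator_of_mem h, indicator_of_mem hmem, indicator_of_mem (hSA s h.1.1 hs h.2),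
            ENNReal.ofReal_pow (by linarith [h3.1])]
          exact pow_le_pow_left' h3.2 _
        · rw [indicator_of_notMem h]
          exact zero_le
    _ = ∫⁻ y, A.indicator (fun y => μ (Iio (y (Fin.last m))) ^ (n - (m + 1))) y
          ∂(Measure.pi fun _ : Fin (m + 1) =>
            μ.restrict ((fun s => arrivalMap i α (s / n)) '' Ioo 0 Y)) := by
        rw [hrest, Measure.restrict_pi_pi, ← Measure.pi_map_pi (fun _ => hτ.aemeasurable),
          lintegral_map hG hτ']
    -- Configurations outside the controlled tail are discarded; a lower bound is all that is
    -- needed.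
    _ ≤ ∫⁻ y, A.indicator (fun y => μ (Iio (y (Fin.last m))) ^ (n - (m + 1))) y
          ∂(Measure.pi fun _ : Fin (m + 1) => μ) := by
        rw [← Measure.restrict_pi_pi]
        exact setLIntegral_le_lintegral _ _
    _ = _ := lintegral_indicator hA _

end

theorem measurable_powNormalize (a b : ℝ) : Measurable (powNormalize a b) := by
  have hsign : Measurable Real.sign := by
    unfold Real.sign
    exact Measurable.ite measurableSet_Iio measurable_const
      (Measurable.ite measurableSet_Ioi measurable_const measurable_const)
  unfold powNormalize
  fun_prop

end PowerNorm

end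

/-! ### The total variation bound. -/

theorem theorem2p4 (x₀ L δ : ℝ) (hx₀ : 1 / 2 < x₀) (hx₀' : x₀ < 1) (hL : 0 < L) (hδ : 0 < δ) :
    ∃ D : ℝ, 0 < D ∧
      ∀ (i : PowerNorm.LawType) (α : ℝ), 0 < α →
      ∀ f g : ℝ → ℝ, Measurable f → (∀ x, 0 ≤ f x) →
        (∀ x : ℝ, PowerNorm.quantileT i α x₀ < x →
          (x : EReal) < PowerNorm.rightEnd (PowerNorm.cdfH i α) →
            f x = PowerNorm.auxW (PowerNorm.cdfH i α) x * Real.exp (g x) ∧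
            |g x| ≤ L * PowerNorm.gRate i α δ x) →
        (∀ x : ℝ, PowerNorm.rightEnd (PowerNorm.cdfH i α) < (x : EReal) → f x = 0) →
      ∀ (n k : ℕ) (hk : 1 ≤ k) (hkn : k ≤ n)
        (Ω : Type*) [MeasurableSpace Ω] (P : Measure Ω) [IsProbabilityMeasure P]
        (X : Fin n → Ω → ℝ), (∀ m, Measurable (X m)) → iIndepFun X P →
        (∀ m, P.map (X m) = volume.withDensity (fun x => ENNReal.ofReal (f x))) →
      ∀ B : Set (Fin k → ℝ), MeasurableSet B →
        |P.real {ω | (fun j : Fin k =>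
              PowerNorm.powNormalize (PowerNorm.normA i n) (PowerNorm.normB i α n)
                (PowerNorm.upperOrderStat hkn (fun m => X m ω) j)) ∈ B}
            - (PowerNorm.limitLaw (PowerNorm.cdfH i α) k hk).real B|
          ≤ D * (((k : ℝ) / n) ^ δ * (k : ℝ) ^ (1 / 2 : ℝ) + (k : ℝ) / n) := by
  open PowerNorm Set in
  have hx0 : 0 < x₀ := by linarith
  set y₀ : ℝ := -Real.log x₀ with hy₀def
  have hy₀ : 0 < y₀ := neg_pos.2 (Real.log_neg hx0 hx₀')
  -- With `y₀ ≤ 1` the factor `(t / n) ^ δ` is at most 1 on `(0, n * y₀)`, so `|φ| ≤ L` everywhere.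
  -- This is where `x₀ > 1 / 2` enters.
  have hy₀1 : y₀ ≤ 1 := by
    have h1 := Real.one_sub_inv_le_log_of_pos hx0
    have h2 : x₀⁻¹ ≤ 2 := by rw [inv_le_comm₀ hx0 two_pos]; linarith
    linarith
  obtain ⟨D, hD, hmain⟩ := exists_poissonArrivals_le L δ y₀ hL hδ hy₀
  refine ⟨D, hD, ?_⟩
  intro i α hα f g hf hf_nonneg hfg hf0 n k hk hkn Ω _ P _ X hX hindep hlaw B hB
  obtain ⟨m, rfl⟩ : ∃ m, k = m + 1 := ⟨k - 1, by omega⟩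
  have hn : 0 < n := by omega
  have hn' : (0 : ℝ) < n := by exact_mod_cast hn
  set r : ℝ := ((m + 1 : ℕ) / n : ℝ) ^ δ * ((m + 1 : ℕ) : ℝ) ^ (1 / 2 : ℝ) + (m + 1 : ℕ) / n
    with hr
  set μ := volume.withDensity fun x => ENNReal.ofReal (f x) with hμdef
  have hμ : IsProbabilityMeasure μ := by
    rw [← hlaw ⟨0, hn⟩]
    exact Measure.isProbabilityMeasure_map (hX _).aemeasurable
  have hτ := measurable_arrivalMap i α
  have hw := measurable_auxW (i := i) hα
  have hT : quantileT i α x₀ = arrivalMap i α y₀ := by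
    rw [arrivalMap, hy₀def, neg_neg, Real.exp_log hx0]
  -- On the controlled range this is `g (τ (s / n))`. It is written through `f / w` because `g` is
  -- not assumed measurable, and extended by 0.
  set φ : ℝ → ℝ := (Ioo 0 (n * y₀)).indicator fun s =>
    Real.log (f (arrivalMap i α (s / n)) / auxW (cdfH i α) (arrivalMap i α (s / n))) with hφdef
  have hφ : Measurable φ := Measurable.indicator (by fun_prop) measurableSet_Ioo
  have hφg : ∀ s, 0 < s → s < n * y₀ → φ s = g (arrivalMap i α (s / n)) ∧
      f (arrivalMap i α (s / n)) =
        auxW (cdfH i α) (arrivalMap i α (s / n)) * Real.exp (φ s) ∧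
      |φ s| ≤ L * (s / n) ^ δ := by
    intro s hs hsY
    have hsn : 0 < s / n := div_pos hs hn'
    have hlt : s / n < y₀ := by rw [div_lt_iff₀ hn']; linarith
    obtain ⟨h1, h2⟩ := hfg (arrivalMap i α (s / n))
      (hT ▸ strictAntiOn_arrivalMap hα hsn hy₀ hlt) (arrivalMap_lt_rightEnd hα hsn)
    have hw0 := right_ne_zero_of_mul_eq_one (abs_deriv_arrivalMap_mul (i := i) hα hsn)
    have h3 : φ s = g (arrivalMap i α (s / n)) := by
      rw [hφdef, indicator_of_mem (show s ∈ Ioo 0 (n * y₀) from ⟨hs, hsY⟩), h1, mul_div_cancel_left₀ _ hw0, Real.log_exp]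
    rw [gRate_arrivalMap i hα δ hsn] at h2
    rw [h3]
    exact ⟨rfl, h1, h2⟩
  have hφa : ∀ t, 0 < t → |φ t| ≤ L * (t / n) ^ δ := by
    intro t ht
    by_cases htY : t < n * y₀
    · exact (hφg t ht htY).2.2
    · rw [hφdef, indicator_of_notMem (fun h => htY h.2), abs_zero]
      positivity
  have hφL : ∀ t, |φ t| ≤ L := by
    intro t
    by_cases ht : t ∈ Ioo 0 (n * y₀)
    · refine (hφg t ht.1 ht.2).2.2.trans ?_
      have h1 : t / n ≤ 1 := by
        rw [div_le_one hn']
        nlinarith [ht.2]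
      have h2 := Real.rpow_le_one (div_nonneg ht.1.le hn'.le) h1 hδ.le
      nlinarith
    · rw [hφdef, indicator_of_notMem ht, abs_zero]
      exact hL.le
  have hpow := measurable_powNormalize (normA i n) (normB i α n)
  have hτ' : Measurable fun (s : Fin (m + 1) → ℝ) j => arrivalMap i α (s j) := by fun_prop
  have hmap : P.map (fun ω m => X m ω) = Measure.pi fun _ : Fin n => μ := by
    rw [(iIndepFun_iff_map_fun_eq_pi_map fun m => (hX m).aemeasurable).1 hindep]
    simp only [hlaw, hμdef]
  have hXm : Measurable fun ω m => X m ω := by fun_prop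
  let S : Set (Fin (m + 1) → ℝ) → Set (Fin (m + 1) → ℝ) :=
    fun B => {s | (fun j => arrivalMap i α (s j)) ∈ B}
  let E : Set (Fin (m + 1) → ℝ) → Set Ω := fun B => {ω | (fun j : Fin (m + 1) =>
    powNormalize (normA i n) (normB i α n)
      (upperOrderStat hkn (fun m => X m ω) j)) ∈ B}
  -- The lower bound is proved for a measurable subset of the order statistic event, so that
  -- measurability of the event itself is never needed. Samples with ties among the largest values
  -- are left out of it.
  have hexists : ∀ B : Set (Fin (m + 1) → ℝ), MeasurableSet B → ∃ U : Set Ω, MeasurableSet U ∧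
      U ⊆ E B ∧ (poissonArrivals m).real (S B) ≤ P.real U + D * r := by
    intro B hB
    set A : Set (Fin (m + 1) → ℝ) :=
      {x | (fun j => powNormalize (normA i n) (normB i α n) (x j)) ∈ B} ∩ {x | StrictAnti x}
      with hAdef
    have hA : MeasurableSet A := MeasurableSet.inter
      ((by fun_prop : Measurable fun (x : Fin (m + 1) → ℝ) j =>
        powNormalize (normA i n) (normB i α n) (x j)) hB) (measurableSet_strictAnti _)
    have hA' : A ⊆ {x | StrictAnti x} := inter_subset_right
    have hUm : MeasurableSet (⋃ σ, topEvent (n := n) A σ) :=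
      MeasurableSet.iUnion fun σ => measurableSet_topEvent hA σ
    refine ⟨(fun ω m => X m ω) ⁻¹' ⋃ σ, topEvent A σ, hXm hUm, ?_, ?_⟩
    · intro ω hω
      obtain ⟨σ, hσ⟩ := mem_iUnion.1 hω
      have h := hσ.2.1
      simp only [E, mem_ofPred_eq, upperOrderStat_of_mem_topEvent hA' hkn hσ]
      exact h
    · have h1 := hmain m n φ hkn hφ hφL hφa (S B) (hτ' hB)
      have h2 := descFactorial_mul_le_pi_topEvent (S := S B) hkn hα hφ hφL
        (fun s hs hsY => (hφg s hs hsY).2.1) hf0 hμ hA hA' (hτ' hB) (by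
          intro s hs hpos hmono
          refine ⟨?_, (strictAnti_arrivalMap_iff hα hn hpos).2 hmono⟩
          simp only [mem_ofPred_eq, powNormalize_arrivalMap i (hpos _) hn]
          exact hs)
      have h3 : P ((fun ω m => X m ω) ⁻¹' ⋃ σ, topEvent A σ) =
          Measure.pi (fun _ : Fin n => μ) (⋃ σ, topEvent A σ) := by
        rw [← hmap, Measure.map_apply hXm hUm]
      have h4 := h1.trans (add_le_add_left h2 _)
      rw [← h3] at h4
      have hr0 : 0 ≤ D * r := by positivity
      have h5 := ENNReal.toReal_mono (by finiteness) h4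
      rw [ENNReal.toReal_add (by finiteness) (by finiteness), ENNReal.toReal_ofReal hr0] at h5
      exact h5
  have hlim : (limitLaw (cdfH i α) (m + 1) hk).real B = (poissonArrivals m).real (S B) := by
    rw [measureReal_def, measureReal_def, limitLaw_apply hα m hB hk]
  obtain ⟨U, -, hUE, hU⟩ := hexists B hB
  -- The one-sided bound for the complement gives the upper bound for `B`, because the limit has
  -- total mass 1 and `E B` lies in the complement of `V`.
  obtain ⟨V, hVm, hVE, hV⟩ := hexists Bᶜ hB.compl
  have hcompl : (poissonArrivals m).real (S Bᶜ) = 1 - (poissonArrivals m).real (S B) :=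
    probReal_compl_eq_one_sub (hτ' hB)
  have h1 : P.real U ≤ P.real (E B) := measureReal_mono hUE
  have h2 : P.real (E B) ≤ 1 - P.real V := by
    rw [← probReal_compl_eq_one_sub hVm]
    exact measureReal_mono fun ω hω hωV => hVE hωV hω
  rw [hlim, abs_le]
  change -(D * r) ≤ P.real (E B) - _ ∧ P.real (E B) - _ ≤ D * r
  constructor <;> linarith
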